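/- A hypergraph \(\mathcal H=(V,\mathcal E)\) is a finite vertex set \(V\) with a set \(\mathcal E\) of subsets of \(V\) (edges); it is \(k\)-uniform if every edge has exactly \(k\) vertices. A Berge path of length \(m\) from \(u\) to \(v\) is a sequence \(u=v_0,H_1,v_1,H_2,\dots,H_m,v_m=v\) with \(v_i\in V\), \(H_i\in\mathcal E\) and \(v_{i-1},v_i\in H_i\) for \(1\le i\le m\); \(\mathcal H\) is connected if any two vertices are joined by a Berge path, and the distance of two vertices is the length of a shortest Berge path between them. A set \(D\subseteq V\) is distance-\(l\) dominating if every vertex is at distance at most \(l\) from some vertex of \(D\), and the distance-\(l\) domination number \(\gamma_d(\mathcal H,l)\) is the minimum size of such a set. Let \(n_{dc}(k,\gamma,l)\) be the minimum number of vertices of a connected \(k\)-uniform hypergraph \(\mathcal H\) with \(\gamma_d(\mathcal H,l)\ge\gamma\), and let \[ f(k,\gamma,l)=\begin{cases}\frac{l}{2}k\gamma+\max\{k,\gamma\} & \text{if } l \text{ is even},\\ \frac{l+1}{2}k\gamma & \text{if } l \text{ is odd}.\end{cases}\] Theorem 2. (a) For all integers \(k,l\ge 2\), \[\frac{(2l+1)k}{2}\le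 n_{dc}(k,2,l)\le\min\left\{\left\lceil\frac{(2l+1)(k+1)}{2}\right\rceil,(l+1)k\right\}.\] (b) For all integers \(k\ge 2\), \(l\ge 4\) and \(\gamma\ge 3\), \[k\left\lceil\left(\frac{l-1}{2}-1\right)\gamma\right\rceil<n_{dc}(k,\gamma,l)\le f(k,\gamma,l).\] (c) For all integers \(k\ge 2\) and \(\gamma\ge 3\), \(k\gamma\le n_{dc}(k,\gamma,2)\le k\gamma+\max\{k,\gamma\}\). (d) For all integers \(k\ge 2\) and \(\gamma\ge 3\), \(k\gamma\le n_{dc}(k,\gamma,3)\le 2k\gamma\). -/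

import Mathlib

namespace Hypergraph

/-- `v 0, e 0, v 1, e 1, …, e (n-1), v n` is a Berge path of length `n` in `H`: all `v i` are
vertices, all `e i` are edges, and each edge contains the vertices before and after it. -/
structure IsBergePath {α : Type*} (H : Hypergraph α) (n : ℕ) (v : Fin (n + 1) → α)
    (e : Fin n → Set α) : Prop where
  vertex_mem : ∀ i, v i ∈ H.vertexSet
  edge_mem : ∀ i, e i ∈ H.edgeSet
  left_mem : ∀ i : Fin n, v i.castSucc ∈ e i
  right_mem : ∀ i : Fin n, v i.succ ∈ e i

/-- There is a Berge path of length `n` from `x` to `y`. -/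
def HasBergePath {α : Type*} (H : Hypergraph α) (n : ℕ) (x y : α) : Prop :=
  ∃ (v : Fin (n + 1) → α) (e : Fin n → Set α),
    H.IsBergePath n v e ∧ v 0 = x ∧ v (Fin.last n) = y

/-- The distance of two vertices: the length of a shortest Berge path between them
(`⊤` if there is none). -/
noncomputable def bergeDist {α : Type*} (H : Hypergraph α) (x y : α) : ℕ∞ :=
  ⨅ (n : ℕ) (_ : H.HasBergePath n x y), (n : ℕ∞)

/-- The ball of radius `l` centered at `x`: the vertices at distance at most `l` from `x`. -/
def bergeBall {α : Type*} (H : Hypergraph α) (l : ℕ) (x : α) : Set α :=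
  {y | y ∈ H.vertexSet ∧ H.bergeDist x y ≤ l}

/-- `D` is a distance-`l` dominating set: a set of vertices whose balls of radius `l` cover all
vertices. -/
def IsDistDominating {α : Type*} (H : Hypergraph α) (l : ℕ) (D : Set α) : Prop :=
  D ⊆ H.vertexSet ∧ ⋃ x ∈ D, H.bergeBall l x = H.vertexSet

/-- The distance-`l` domination number: the least size of a distance-`l` dominating set. -/
noncomputable def distDomNumber {α : Type*} (H : Hypergraph α) (l : ℕ) : ℕ∞ :=
  ⨅ (D : Set α) (_ : H.IsDistDominating l D), D.encard

/-- Every edge has exactly `k` vertices. -/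
def IsUniform {α : Type*} (H : Hypergraph α) (k : ℕ) : Prop :=
  ∀ e ∈ H.edgeSet, e.encard = k

/-- The vertex set is non-empty and any two vertices are joined by a Berge path. -/
def IsBergeConnected {α : Type*} (H : Hypergraph α) : Prop :=
  H.vertexSet.Nonempty ∧ ∀ x ∈ H.vertexSet, ∀ y ∈ H.vertexSet, ∃ n, H.HasBergePath n x y

/-- The orders of the finite connected `k`-uniform hypergraphs with distance-`l` domination
number at least `γ`. -/
def distConnOrders (k γ l : ℕ) : Set ℕ :=
  {n | ∃ (α : Type) (H : Hypergraph α), H.vertexSet.encard = n ∧ H.IsUniform k ∧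
    H.IsBergeConnected ∧ (γ : ℕ∞) ≤ H.distDomNumber l}

/-- The least order of a connected `k`-uniform hypergraph with distance-`l` domination number at
least `γ`. As an infimum in `ℕ` it is attained as soon as it is positive. -/
noncomputable def ndc (k γ l : ℕ) : ℕ :=
  sInf (distConnOrders k γ l)

/-- The upper bound `f(k, γ, l)`. -/
noncomputable def ndcUpper (k γ l : ℕ) : ℝ :=
  if Even l then (l : ℝ) / 2 * k * γ + max (k : ℝ) (γ : ℝ)
  else ((l : ℝ) + 1) / 2 * k * γ

end Hypergraph

/-!
The lower bounds come from the intersection graph of the hypergraph, whose vertices are the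
hyperedges. A walk of length `m` there gives a Berge path of length `m + 1` between any vertex of its
first and any vertex of its last hyperedge.

**Lower bound for `γ = 2`.** If every vertex has another one at distance more than `l`, then every
edge `ef` of the intersection graph has a vertex `g` at distance at least `l` from both `e` and `f`
(take `g` around a vertex far from a point of `e ∩ f`). The purely graph-theoretic
`SimpleGraph.EdgeRadiusGE.exists_triangleFreeOn` produces from this, for `l ≥ 2`, a set of `2 l + 1`
vertices spanning no triangle. As hyperedges, these cover each vertex at most twice, so that
`(2 l + 1) k ≤ 2 n`. The proof passes to an induced subgraph that is minimal with the property;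
deleting a non-cut vertex `v` then leaves an edge `cc'` which is within distance `l - 1` of
everything but `v`. Geodesics with `l` vertices that lead from `c`, `c'` and a neighbour of them to
vertices far from the other two (arms) can only be joined level by level, and two suitable arms with
one more vertex span no triangle.

**Lower bound for general `γ`.** A maximal independent set `M` of the intersection graph can be grown
by steps of length two, so that it carries a connected graph whose edges join hyperedges at distance
two. By the theorem of Meir and Moon this graph has a distance-`s` dominating set of at most
`|M| / (s + 1)` elements, or of one element; one vertex from each of these hyperedges dominates the
hypergraph within distance `2 s + 2`. For `2 s + 2 ≤ l` and `γ ≥ 2` this gives `γ (s + 1) ≤ |M|`, and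
the members of `M` are disjoint, so `γ (s + 1) k ≤ n`. With `s + 1 = ⌊l / 2⌋` this implies all the
lower bounds for `γ ≥ 3`.

**Upper bounds.** A spider with `γ` arms of `l + 1` layers, whose sizes alternate between `1` and
`k - 1` and whose top layers belong to a complete hub, needs a dominating vertex in every arm; it
has `f(k, γ, l)` vertices, which is `(l + 1) k` for `γ = 2`. For `γ = 2` and `k ≥ 3`, a cycle of
`2 l + 1` edges, each with a vertex of its own and sharing about `(k - 1) / 2` vertices with the next,
has the other order in the minimum: the private vertices of an edge are at distance `l + 1` from the
vertices opposite to them.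
-/

/-! ### Geodesics and large triangle-free sets in graphs of large radius -/

namespace SimpleGraph

variable {V : Type*} {G : SimpleGraph V}

/-- A geodesic of length `n` in `G`, encoded as a function on `ℕ` of which only the values at
`0, …, n` matter. -/
def IsGeodesic (G : SimpleGraph V) (n : ℕ) (f : ℕ → V) : Prop :=
  ∀ i j, i ≤ j → j ≤ n → G.dist (f i) (f j) = j - i

lemma Connected.exists_adj_dist_eq (hG : G.Connected) {a b : V} {n : ℕ}
    (h : G.dist a b = n + 1) : ∃ c, G.Adj a c ∧ G.dist c b = n := by
  obtain ⟨w, hw⟩ := hG.exists_walk_length_eq_dist a b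
  cases w with
  | nil => simp at h
  | @cons _ c _ hac w =>
    refine ⟨c, hac, ?_⟩
    have h1 := dist_le w
    have h2 := hG.dist_triangle (u := a) (v := c) (w := b)
    have h3 := dist_eq_one_iff_adj.2 hac
    simp only [Walk.length_cons] at hw
    omega

lemma Connected.exists_isGeodesic (hG : G.Connected) (n : ℕ) : ∀ {a b : V}, G.dist a b = n →
    ∃ f : ℕ → V, f 0 = a ∧ f n = b ∧ G.IsGeodesic n f := by
  induction n with
  | zero =>
    intro a b h
    refine ⟨fun _ => a, rfl, hG.dist_eq_zero_iff.1 h, fun i j _ hj => ?_⟩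
    simp only [dist_self]
    omega
  | succ n ih =>
    intro a b h
    obtain ⟨c, hac, hc⟩ := hG.exists_adj_dist_eq h
    obtain ⟨f, hf0, hfn, hf⟩ := ih hc
    refine ⟨fun i => Nat.casesOn i a f, rfl, hfn, fun i j hij hj => ?_⟩
    have key : ∀ j ≤ n, G.dist a (f j) = j + 1 := by
      intro j hj
      have h1 := hf 0 j (by omega) hj
      have h2 := hf j n hj le_rfl
      have h3 := hG.dist_triangle (u := a) (v := c) (w := f j)
      have h4 := hG.dist_triangle (u := a) (v := f j) (w := b)
      have h5 := dist_eq_one_iff_adj.2 hac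
      rw [hf0] at h1
      rw [hfn] at h2
      omega
    rcases i with _ | i <;> rcases j with _ | j
    · simp
    · simpa using key j (by omega)
    · omega
    · simpa using hf i j (by omega) (by omega)

lemma IsGeodesic.adj {n : ℕ} {f : ℕ → V} (hf : G.IsGeodesic n f) {i : ℕ} (hi : i < n) :
    G.Adj (f i) (f (i + 1)) := by
  rw [← dist_eq_one_iff_adj, hf i (i + 1) (by omega) (by omega)]
  omega

lemma IsGeodesic.adj_iff {n : ℕ} {f : ℕ → V} (hf : G.IsGeodesic n f) {i j : ℕ} (hi : i ≤ n)
    (hj : j ≤ n) : G.Adj (f i) (f j) ↔ j = i + 1 ∨ i = j + 1 := by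
  rw [← dist_eq_one_iff_adj]
  rcases le_total i j with h | h
  · rw [hf i j h hj]; omega
  · rw [dist_comm, hf j i h hi]; omega

lemma IsGeodesic.injOn {n : ℕ} {f : ℕ → V} (hf : G.IsGeodesic n f) {i j : ℕ} (hi : i ≤ n)
    (hj : j ≤ n) (h : f i = f j) : i = j := by
  rcases le_total i j with hij | hij
  · have := hf i j hij hj
    rw [h, dist_self] at this; omega
  · have := hf j i hij hi
    rw [h, dist_self] at this; omega

/-- Two geodesics of the same length `n`, such that the end of each is at distance more than `n`
from the start of the other. -/
structure IsArmPair (G : SimpleGraph V) (n : ℕ) (f g : ℕ → V) : Prop where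
  left : G.IsGeodesic n f
  right : G.IsGeodesic n g
  left_far : n < G.dist (f n) (g 0)
  right_far : n < G.dist (g n) (f 0)

/-- Edges between the two arms join vertices of the same level: an edge between different levels
would be a shortcut from the end of one arm to the start of the other. -/
lemma IsArmPair.eq_of_adj (hG : G.Connected) {n : ℕ} {f g : ℕ → V} (h : G.IsArmPair n f g)
    {i j : ℕ} (hi : i ≤ n) (hj : j ≤ n) (hadj : G.Adj (f i) (g j)) : i = j := by
  have h1 := h.left 0 i (by omega) hi
  have h2 := h.left i n hi le_rfl
  have h3 := h.right 0 j (by omega) hj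
  have h4 := h.right j n hj le_rfl
  have h5 := dist_eq_one_iff_adj.2 hadj
  have h6 := hG.dist_triangle (u := g 0) (v := g j) (w := f n)
  have h7 := hG.dist_triangle (u := g j) (v := f i) (w := f n)
  have h8 := hG.dist_triangle (u := f 0) (v := f i) (w := g n)
  have h9 := hG.dist_triangle (u := f i) (v := g j) (w := g n)
  have h10 := h.left_far
  have h11 := h.right_far
  rw [dist_comm] at h10 h11
  rw [dist_comm (u := g j) (v := f i)] at h7
  omega

lemma IsArmPair.ne (hG : G.Connected) {n : ℕ} {f g : ℕ → V} (h : G.IsArmPair n f g)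
    {i j : ℕ} (hi : i ≤ n) (hj : j ≤ n) : f i ≠ g j := by
  intro he
  have h1 := h.left 0 i (by omega) hi
  have h2 := h.left i n hi le_rfl
  have h3 := h.right 0 j (by omega) hj
  have h4 := h.right j n hj le_rfl
  have h6 := hG.dist_triangle (u := g 0) (v := g j) (w := f n)
  have h8 := hG.dist_triangle (u := f 0) (v := f i) (w := g n)
  have h10 := h.left_far
  have h11 := h.right_far
  rw [dist_comm] at h10 h11
  rw [he] at h1 h2 h8
  omega

/-- No three vertices of `S` are pairwise adjacent. -/
def TriangleFreeOn (G : SimpleGraph V) (S : Finset V) : Prop :=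
  ∀ a ∈ S, ∀ b ∈ S, ∀ c ∈ S, G.Adj a b → G.Adj b c → ¬ G.Adj a c

/-- Two arms and a further vertex `z` whose neighbours on the arms lie on one level, and which does
not close a triangle there. -/
lemma IsArmPair.exists_triangleFreeOn (hG : G.Connected) {n : ℕ} {f g : ℕ → V}
    (h : G.IsArmPair n f g) {z : V} (m : ℕ)
    (hf : ∀ i ≤ n, z ≠ f i) (hg : ∀ i ≤ n, z ≠ g i)
    (hzf : ∀ i ≤ n, G.Adj z (f i) → i = m) (hzg : ∀ i ≤ n, G.Adj z (g i) → i = m)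
    (hm : G.Adj z (f m) → G.Adj z (g m) → ¬ G.Adj (f m) (g m)) :
    ∃ S : Finset V, S.card = 2 * (n + 1) + 1 ∧ G.TriangleFreeOn S := by
  classical
  let F := (Finset.range (n + 1)).image f
  let K := (Finset.range (n + 1)).image g
  have hF : F.card = n + 1 := by
    rw [Finset.card_image_of_injOn, Finset.card_range]
    intro i hi j hj hij
    simp only [Finset.coe_range, Set.mem_Iio] at hi hj
    exact h.left.injOn (by omega) (by omega) hij
  have hK : K.card = n + 1 := by
    rw [Finset.card_image_of_injOn, Finset.card_range]
    intro i hi j hj hij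
    simp only [Finset.coe_range, Set.mem_Iio] at hi hj
    exact h.right.injOn (by omega) (by omega) hij
  have hFK : Disjoint F K := by
    rw [Finset.disjoint_left]
    intro a ha hb
    simp only [F, K, Finset.mem_image, Finset.mem_range] at ha hb
    obtain ⟨i, hi, rfl⟩ := ha
    obtain ⟨j, hj, hij⟩ := hb
    exact h.ne hG (by omega) (by omega) hij.symm
  have hzFK : z ∉ F ∪ K := by
    simp only [F, K, Finset.mem_union, Finset.mem_image, Finset.mem_range, not_or, not_exists,
      not_and]
    exact ⟨fun i hi he => hf i (by omega) he.symm, fun i hi he => hg i (by omega) he.symm⟩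
  refine ⟨insert z (F ∪ K), ?_, ?_⟩
  · rw [Finset.card_insert_of_notMem hzFK, Finset.card_union_of_disjoint hFK]
    omega
  have hmem : ∀ a ∈ insert z (F ∪ K), a = z ∨ ∃ s : Bool, ∃ i ≤ n, a = cond s (f i) (g i) := by
    intro a ha
    simp only [F, K, Finset.mem_insert, Finset.mem_union, Finset.mem_image, Finset.mem_range] at ha
    rcases ha with rfl | ⟨i, hi, rfl⟩ | ⟨i, hi, rfl⟩
    · exact Or.inl rfl
    · exact Or.inr ⟨true, i, by omega, rfl⟩
    · exact Or.inr ⟨false, i, by omega, rfl⟩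
  have hadj : ∀ (s t : Bool) (i j : ℕ), i ≤ n → j ≤ n →
      G.Adj (cond s (f i) (g i)) (cond t (f j) (g j)) →
      (s = t ∧ (j = i + 1 ∨ i = j + 1)) ∨ (s ≠ t ∧ i = j) := by
    intro s t i j hi hj hij
    cases s <;> cases t
    · exact Or.inl ⟨rfl, (h.right.adj_iff hi hj).1 hij⟩
    · exact Or.inr ⟨by simp, (h.eq_of_adj hG hj hi hij.symm).symm⟩
    · exact Or.inr ⟨by simp, h.eq_of_adj hG hi hj hij⟩
    · exact Or.inl ⟨rfl, (h.left.adj_iff hi hj).1 hij⟩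
  have hz : ∀ (s t : Bool) (i j : ℕ), i ≤ n → j ≤ n → G.Adj z (cond s (f i) (g i)) →
      G.Adj z (cond t (f j) (g j)) → ¬ G.Adj (cond s (f i) (g i)) (cond t (f j) (g j)) := by
    intro s t i j hi hj h1 h2 h3
    cases s <;> cases t
    · obtain rfl := hzg i hi h1
      obtain rfl := hzg j hj h2
      exact G.irrefl h3
    · obtain rfl := hzg i hi h1
      obtain rfl := hzf j hj h2
      exact hm h2 h1 h3.symm
    · obtain rfl := hzf i hi h1
      obtain rfl := hzg j hj h2
      exact hm h1 h2 h3
    · obtain rfl := hzf i hi h1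
      obtain rfl := hzf j hj h2
      exact G.irrefl h3
  intro a ha b hb c hc hab hbc hac
  rcases hmem a ha with rfl | ⟨s, i, hi, rfl⟩ <;>
  rcases hmem b hb with rfl | ⟨t, j, hj, rfl⟩ <;>
  rcases hmem c hc with rfl | ⟨u, k, hk, rfl⟩
  · exact G.irrefl hab
  · exact G.irrefl hab
  · exact G.irrefl hac
  · exact hz t u j k hj hk hab hac hbc
  · exact G.irrefl hbc
  · exact hz s u i k hi hk hab.symm hbc hac
  · exact hz s t i j hi hj hac.symm hbc.symm hab
  · have h1 := hadj s t i j hi hj hab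
    have h2 := hadj t u j k hj hk hbc
    have h3 := hadj s u i k hi hk hac
    cases s <;> cases t <;> cases u <;> simp at h1 h2 h3 <;> omega

/-- Every edge `ab` has a vertex at distance at least `l` from both `a` and `b`. -/
def EdgeRadiusGE (G : SimpleGraph V) (l : ℕ) : Prop :=
  ∀ a b, G.Adj a b → ∃ g, l ≤ G.dist a g ∧ l ≤ G.dist b g

/-- The case in which only the vertex `v` is at distance at least `n + 1` from both ends of the edge
`cc'`. -/
lemma EdgeRadiusGE.exists_triangleFreeOn_of_center (hG : G.Connected) {n : ℕ} (hn : 1 ≤ n)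
    (hr : G.EdgeRadiusGE (n + 1)) {c c' v : V} (hcc : G.Adj c c')
    (hv : G.dist c v = n + 1) (hv' : n + 1 ≤ G.dist c' v)
    (hnear : ∀ g, g ≠ v → G.dist c g ≤ n ∨ G.dist c' g ≤ n) :
    ∃ S : Finset V, S.card = 2 * (n + 1) + 1 ∧ G.TriangleFreeOn S := by
  have hstep : ∀ {a b : V} (x : V), G.Adj a b → G.dist a x ≤ G.dist b x + 1 := by
    intro a b x hab
    have h1 := dist_eq_one_iff_adj.2 hab
    have h2 := hG.dist_triangle (u := a) (v := b) (w := x)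
    omega
  obtain ⟨p, hcp, hpv⟩ := hG.exists_adj_dist_eq hv
  obtain ⟨x, hcx, hpx⟩ := hr c p hcp
  have hxv : x ≠ v := by rintro rfl; omega
  have hx : G.dist c' x = n := by
    have := hnear x hxv
    have := hstep x hcc
    omega
  obtain ⟨P, hP0, hPn, hP⟩ := hG.exists_isGeodesic n hpv
  obtain ⟨Q, hQ0, hQn, hQ⟩ := hG.exists_isGeodesic n hx
  have hPQ : G.IsArmPair n P Q := by
    refine ⟨hP, hQ, ?_, ?_⟩
    · rw [hPn, hQ0, dist_comm]; omega
    · rw [hQn, hP0, dist_comm]; omega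
  have hcP : ∀ i ≤ n, G.dist c (P i) = i + 1 := by
    intro i hi
    have h1 := hP 0 i (by omega) hi
    have h2 := hP i n hi le_rfl
    have h3 := hG.dist_triangle (u := c) (v := P i) (w := v)
    have h4 := hstep (P i) hcp
    rw [hP0] at h1
    rw [hPn] at h2
    omega
  have hc'P : ∀ i ≤ n, i < G.dist c' (P i) := by
    intro i hi
    have h2 := hP i n hi le_rfl
    have h3 := hG.dist_triangle (u := c') (v := P i) (w := v)
    rw [hPn] at h2
    omega
  have hcQ : ∀ i ≤ n, i < G.dist c (Q i) := by
    intro i hi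
    have h2 := hQ i n hi le_rfl
    have h3 := hG.dist_triangle (u := c) (v := Q i) (w := x)
    rw [hQn] at h2
    omega
  by_cases hcp' : G.Adj c' p
  swap
  · -- The base points `c, c', p` do not span a triangle: add `c` to the two arms.
    refine hPQ.exists_triangleFreeOn hG (z := c) 0 ?_ ?_ ?_ ?_ ?_
    · intro i hi he
      have := hcP i hi
      rw [← he, dist_self] at this
      omega
    · intro i hi he
      have := hcQ i hi
      rw [← he, dist_self] at this
      omega
    · intro i hi hadj
      have := hcP i hi
      rw [dist_eq_one_iff_adj.2 hadj] at this
      omega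
    · intro i hi hadj
      have := hcQ i hi
      rw [dist_eq_one_iff_adj.2 hadj] at this
      omega
    · intro _ _ hadj
      rw [hP0, hQ0] at hadj
      exact hcp' hadj.symm
  obtain ⟨y, hcy', hpy⟩ := hr c' p hcp'
  have hyv : y ≠ v := by rintro rfl; omega
  have hy : G.dist c y = n := by
    have := hnear y hyv
    have := hstep y hcc.symm
    omega
  obtain ⟨R, hR0, hRn, hR⟩ := hG.exists_isGeodesic n hy
  have hRP : G.IsArmPair n R P := by
    refine ⟨hR, hP, ?_, ?_⟩
    · rw [hRn, hP0, dist_comm]; omega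
    · rw [hPn, hR0, dist_comm]; omega
  have hRQ : G.IsArmPair n R Q := by
    refine ⟨hR, hQ, ?_, ?_⟩
    · rw [hRn, hQ0, dist_comm]; omega
    · rw [hQn, hR0, dist_comm]; omega
  by_cases hRP1 : G.Adj (R 1) (P 1)
  swap
  · -- Level one is not a triangle: add `R 1` to the arms `P` and `Q`.
    refine hPQ.exists_triangleFreeOn hG (z := R 1) 1 ?_ ?_ ?_ ?_ ?_
    · exact fun i hi => hRP.ne hG hn hi
    · exact fun i hi => hRQ.ne hG hn hi
    · exact fun i hi hadj => (hRP.eq_of_adj hG hn hi hadj).symm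
    · exact fun i hi hadj => (hRQ.eq_of_adj hG hn hi hadj).symm
    · exact fun hadj _ _ => hRP1 hadj
  -- Now `R 1` is close to `v`, so that a vertex far from the edge `R 0, R 1` gives a new arm `T`.
  obtain ⟨w, hcw, hRw⟩ := hr (R 0) (R 1) (hR.adj hn)
  have hwv : w ≠ v := by
    rintro rfl
    have h1 := hP 1 n hn le_rfl
    have h2 := hstep w hRP1
    rw [hPn] at h1
    omega
  rw [hR0] at hcw
  have hw : G.dist c' w = n := by
    have := hnear w hwv
    have := hstep w hcc
    omega
  obtain ⟨T, hT0, hTn, hT⟩ := hG.exists_isGeodesic n hw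
  have hRT : G.IsArmPair n R T := by
    refine ⟨hR, hT, ?_, ?_⟩
    · rw [hRn, hT0, dist_comm]; omega
    · rw [hTn, hR0, dist_comm]; omega
  have hvR : ∀ i ≤ n, n + 1 - i ≤ G.dist v (R i) := by
    intro i hi
    have h1 := hR 0 i (by omega) hi
    have h2 := hG.dist_triangle (u := c) (v := R i) (w := v)
    rw [hR0] at h1
    rw [dist_comm (u := R i) (v := v)] at h2
    omega
  have hvT : ∀ i ≤ n, n + 1 - i ≤ G.dist v (T i) := by
    intro i hi
    have h1 := hT 0 i (by omega) hi
    have h2 := hG.dist_triangle (u := c') (v := T i) (w := v)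
    rw [hT0] at h1
    rw [dist_comm (u := T i) (v := v)] at h2
    omega
  refine hRT.exists_triangleFreeOn hG (z := v) n ?_ ?_ ?_ ?_ ?_
  · intro i hi he
    have := hvR i hi
    rw [← he, dist_self] at this
    omega
  · intro i hi he
    have := hvT i hi
    rw [← he, dist_self] at this
    omega
  · intro i hi hadj
    have := hvR i hi
    rw [dist_eq_one_iff_adj.2 hadj] at this
    omega
  · intro i hi hadj
    have := hvT i hi
    rw [dist_eq_one_iff_adj.2 hadj] at this
    omega
  · -- An edge between the ends of `R` and `T` would bring `w` too close to `R 1`.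
    intro _ _ hadj
    have h1 := hR 1 n hn le_rfl
    have h2 := hG.dist_triangle (u := R 1) (v := R n) (w := w)
    have h3 := dist_eq_one_iff_adj.2 hadj
    rw [hTn] at h3
    omega

/-- A connected graph in which every edge has a vertex at distance at least `n + 1 ≥ 2` from both its
ends has `2 (n + 1) + 1` vertices spanning no triangle. -/
theorem EdgeRadiusGE.exists_triangleFreeOn {n : ℕ} (hn : 1 ≤ n) {V : Type*} [Finite V]
    [Nontrivial V] {G : SimpleGraph V} (hG : G.Connected) (hr : G.EdgeRadiusGE (n + 1)) :
    ∃ S : Finset V, S.card = 2 * (n + 1) + 1 ∧ G.TriangleFreeOn S := by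
  classical
  induction hm : Nat.card V using Nat.strong_induction_on generalizing V with
  | _ m ih =>
  obtain ⟨v, hvc⟩ := hG.exists_connected_induce_compl_singleton_of_finite_nontrivial
  obtain ⟨v', hadj⟩ := hG.preconnected.exists_adj_of_nontrivial v
  have hle : ∀ a b : ({v}ᶜ : Set V), G.dist a b ≤ (G.induce {v}ᶜ).dist a b := by
    intro a b
    obtain ⟨w, hw⟩ := hvc.exists_walk_length_eq_dist a b
    rw [← hw]
    exact (dist_le (w.map (Embedding.induce _).toHom)).trans_eq (Walk.length_map ..)
  have hnt : Nontrivial ({v}ᶜ : Set V) := by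
    obtain ⟨g, hg1, hg2⟩ := hr v v' hadj
    refine ⟨⟨v', hadj.ne'⟩, ⟨g, ?_⟩, ?_⟩
    · rintro rfl
      simp at hg1
    · intro he
      obtain rfl : v' = g := congrArg Subtype.val he
      simp at hg2
  by_cases hr' : (G.induce {v}ᶜ).EdgeRadiusGE (n + 1)
  · have hlt : Nat.card ({v}ᶜ : Set V) < m := by
      rw [← hm]
      exact Finite.card_subtype_lt (x := v) (by simp)
    obtain ⟨S, hS, hST⟩ := ih _ hlt hvc hr' rfl
    refine ⟨S.map (Function.Embedding.subtype _), by simpa using hS, ?_⟩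
    intro a ha b hb c hc hab hbc hac
    simp only [Finset.mem_map, Function.Embedding.subtype_apply] at ha hb hc
    obtain ⟨a, ha, rfl⟩ := ha
    obtain ⟨b, hb, rfl⟩ := hb
    obtain ⟨c, hc, rfl⟩ := hc
    exact hST a ha b hb c hc hab hbc hac
  · simp only [EdgeRadiusGE, not_forall, not_exists, not_and, not_le, exists_prop] at hr'
    obtain ⟨c, c', hcc, hnear⟩ := hr'
    have hcc' : G.Adj c c' := hcc
    have hnear' : ∀ g, g ≠ v → G.dist c g ≤ n ∨ G.dist c' g ≤ n := by
      intro g hg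
      have h1 := hnear ⟨g, hg⟩
      have h2 := hle c ⟨g, hg⟩
      have h3 := hle c' ⟨g, hg⟩
      simp only at h2 h3
      omega
    obtain ⟨g, hg1, hg2⟩ := hr c c' hcc'
    obtain rfl : g = v := by
      by_contra hg
      have := hnear' g hg
      omega
    have hv' := hnear' v' hadj.ne'
    have hd := dist_eq_one_iff_adj.2 hadj.symm
    have ht := hG.dist_triangle (u := (c : V)) (v := v') (w := g)
    have ht' := hG.dist_triangle (u := (c' : V)) (v := v') (w := g)
    rcases hv' with hv' | hv'
    · exact hr.exists_triangleFreeOn_of_center hG hn hcc' (by omega) hg2 hnear'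
    · exact hr.exists_triangleFreeOn_of_center hG hn hcc'.symm (by omega) hg1
        (fun g hg => (hnear' g hg).symm)

end SimpleGraph

/-! ### Distance domination in connected graphs -/

namespace SimpleGraph

variable {V : Type*} {G : SimpleGraph V}

/-- A spanning tree of `G` with root `r`: every vertex `v ≠ r` has the neighbour `p v` as its
parent, and `h v` is the height of `v` above the root. The value `p r` is irrelevant. -/
structure IsRootedTree (G : SimpleGraph V) (r : V) (p : V → V) (h : V → ℕ) : Prop where
  height_root : h r = 0
  adj : ∀ v, v ≠ r → G.Adj v (p v)
  height : ∀ v, v ≠ r → h v = h (p v) + 1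

lemma Connected.exists_isRootedTree (hG : G.Connected) (r : V) :
    ∃ p h, G.IsRootedTree r p h := by
  have : ∀ v, ∃ w, v ≠ r → G.Adj v w ∧ G.dist v r = G.dist w r + 1 := by
    intro v
    by_cases hv : v = r
    · exact ⟨v, fun h => absurd hv h⟩
    obtain ⟨w, hvw, hw⟩ := hG.exists_adj_dist_eq (a := v) (b := r) (n := G.dist v r - 1)
      (by have := hG.pos_dist_of_ne hv; omega)
    refine ⟨w, fun _ => ⟨hvw, ?_⟩⟩
    have := hG.pos_dist_of_ne hv
    omega
  choose p hp using this
  exact ⟨p, fun v => G.dist v r, by simp, fun v hv => (hp v hv).1, fun v hv => (hp v hv).2⟩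

namespace IsRootedTree

variable {r : V} {p : V → V} {h : V → ℕ}

lemma ne_root (H : G.IsRootedTree r p h) {v : V} (hv : 0 < h v) : v ≠ r := by
  rintro rfl
  rw [H.height_root] at hv
  omega

lemma eq_root (H : G.IsRootedTree r p h) {v : V} (hv : h v = 0) : v = r := by
  by_contra hne
  have := H.height v hne
  omega

lemma height_iterate (H : G.IsRootedTree r p h) {v : V} (t : ℕ) (ht : t ≤ h v) :
    h (p^[t] v) + t = h v := by
  induction t with
  | zero => simp
  | succ t ih =>
    have h1 := ih (by omega)
    have h2 := H.height (p^[t] v) (H.ne_root (by omega))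
    rw [Function.iterate_succ_apply']
    omega

lemma dist_iterate_le (H : G.IsRootedTree r p h) (hG : G.Connected) {v : V} (t : ℕ)
    (ht : t ≤ h v) : G.dist (p^[t] v) v ≤ t := by
  induction t with
  | zero => simp
  | succ t ih =>
    have h1 := ih (by omega)
    have h2 := H.height_iterate t (v := v) (by omega)
    have h3 := dist_eq_one_iff_adj.2 (H.adj (p^[t] v) (H.ne_root (by omega))).symm
    have h4 := hG.dist_triangle (u := p (p^[t] v)) (v := p^[t] v) (w := v)
    rw [Function.iterate_succ_apply']
    omega

/-- A subtree containing the root, as a set of vertices closed under taking parents. -/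
structure IsSubtree (r : V) (p : V → V) (S : Finset V) : Prop where
  root_mem : r ∈ S
  parent_mem : ∀ v ∈ S, v ≠ r → p v ∈ S

lemma iterate_mem (H : G.IsRootedTree r p h) {S : Finset V} (hS : IsSubtree r p S) {v : V}
    (hv : v ∈ S) (t : ℕ) (ht : t ≤ h v) : p^[t] v ∈ S := by
  induction t with
  | zero => exact hv
  | succ t ih =>
    have h2 := H.height_iterate t (v := v) (by omega)
    rw [Function.iterate_succ_apply']
    exact hS.parent_mem _ (ih (by omega)) (H.ne_root (by omega))

/-- The diameter of a subtree is less than its order (a highest vertex is a leaf). -/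
lemma dist_lt_card (H : G.IsRootedTree r p h) (hG : G.Connected) :
    ∀ (m : ℕ) {S : Finset V}, S.card = m → IsSubtree r p S → ∀ v ∈ S, ∀ w ∈ S,
      G.dist v w < m := by
  classical
  intro m
  induction m with
  | zero =>
    intro S hm hS
    rw [Finset.card_eq_zero.1 hm] at hS
    exact absurd hS.root_mem (Finset.notMem_empty r)
  | succ m ih =>
    intro S hm hS v hv w hw
    obtain ⟨x, hx, hmax⟩ := S.exists_max_image h ⟨r, hS.root_mem⟩
    by_cases hxr : x = r
    · have h0 : ∀ u ∈ S, u = r := fun u hu => H.eq_root (by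
        have := hmax u hu
        rw [hxr, H.height_root] at this
        omega)
      rw [h0 v hv, h0 w hw, dist_self]
      omega
    have hS' : IsSubtree r p (S.erase x) := by
      refine ⟨Finset.mem_erase.2 ⟨Ne.symm hxr, hS.root_mem⟩, fun u hu hur => ?_⟩
      rw [Finset.mem_erase] at hu ⊢
      refine ⟨fun he => ?_, hS.parent_mem u hu.2 hur⟩
      have h1 := H.height u hur
      have h2 := hmax u hu.2
      rw [he] at h1
      omega
    have hcard : (S.erase x).card = m := by rw [Finset.card_erase_of_mem hx]; omega
    have hpx : p x ∈ S.erase x := by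
      rw [Finset.mem_erase]
      refine ⟨fun he => ?_, hS.parent_mem x hx hxr⟩
      have := H.height x hxr
      rw [he] at this
      omega
    have hd := dist_eq_one_iff_adj.2 (H.adj x hxr)
    have key : ∀ u ∈ S, G.dist x u < m + 1 := by
      intro u hu
      by_cases hux : u = x
      · rw [hux, dist_self]; omega
      · have h1 := ih hcard hS' (p x) hpx u (Finset.mem_erase.2 ⟨hux, hu⟩)
        have h2 := hG.dist_triangle (u := x) (v := p x) (w := u)
        omega
    by_cases hvx : v = x
    · rw [hvx]; exact key w hw
    by_cases hwx : w = x
    · rw [hwx, dist_comm]; exact key v hv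
    have := ih hcard hS' v (Finset.mem_erase.2 ⟨hvx, hv⟩) w (Finset.mem_erase.2 ⟨hwx, hw⟩)
    omega

/-- Cut off the branch at the ancestor `u`, `s` steps below a highest vertex `x`: it has at least
`s + 1` vertices, all within distance `s` of `u`, and what remains is a subtree. -/
lemma exists_dominating (H : G.IsRootedTree r p h) (hG : G.Connected) (s : ℕ) :
    ∀ (m : ℕ) {S : Finset V}, S.card = m → IsSubtree r p S →
      ∃ D ⊆ S, (D.card = 1 ∨ D.card * (s + 1) ≤ m) ∧ ∀ v ∈ S, ∃ d ∈ D, G.dist d v ≤ s := by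
  classical
  intro m
  induction m using Nat.strong_induction_on with
  | _ m ih =>
  intro S hm hS
  obtain ⟨x, hx, hmax⟩ := S.exists_max_image h ⟨r, hS.root_mem⟩
  by_cases hxs : h x ≤ s
  · refine ⟨{r}, by simpa using hS.root_mem, Or.inl (by simp), fun v hv => ⟨r, by simp, ?_⟩⟩
    have h1 := H.dist_iterate_le hG (v := v) (h v) le_rfl
    have h2 := H.height_iterate (v := v) (h v) le_rfl
    rw [H.eq_root (v := p^[h v] v) (by omega)] at h1
    exact h1.trans ((hmax v hv).trans hxs)
  push Not at hxs
  set u := p^[s] x with hu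
  have huh : h u + s = h x := H.height_iterate s hxs.le
  have hur : u ≠ r := H.ne_root (by omega)
  have huS : u ∈ S := H.iterate_mem hS hx s hxs.le
  let B := S.filter fun v => h u ≤ h v ∧ p^[h v - h u] v = u
  have hBcard : s + 1 ≤ B.card := by
    rw [← Finset.card_range (s + 1)]
    refine Finset.card_le_card_of_injOn (fun t => p^[t] x) ?_ ?_
    · intro t ht
      simp only [Finset.coe_range, Set.mem_Iio] at ht
      have h1 := H.height_iterate t (v := x) (by omega)
      simp only [B, Finset.coe_filter, Set.mem_ofPred_eq]
      refine ⟨H.iterate_mem hS hx t (by omega), by omega, ?_⟩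
      rw [← Function.iterate_add_apply, show h (p^[t] x) - h u + t = s by omega]
    · intro t ht t' ht' he
      simp only [Finset.coe_range, Set.mem_Iio] at ht ht'
      have h1 := H.height_iterate t (v := x) (by omega)
      have h2 := H.height_iterate t' (v := x) (by omega)
      simp only at he
      rw [he] at h1
      omega
  have hBdist : ∀ v ∈ B, G.dist u v ≤ s := by
    intro v hv
    simp only [B, Finset.mem_filter] at hv
    have h1 := H.dist_iterate_le hG (v := v) (h v - h u) (by omega)
    rw [hv.2.2] at h1
    have := hmax v hv.1
    omega
  have hS' : IsSubtree r p (S \ B) := by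
    constructor
    · simp only [B, Finset.mem_sdiff, Finset.mem_filter, not_and]
      refine ⟨hS.root_mem, fun _ hr => ?_⟩
      rw [H.height_root] at hr
      omega
    · intro v hv hvr
      simp only [B, Finset.mem_sdiff, Finset.mem_filter, not_and] at hv ⊢
      refine ⟨hS.parent_mem v hv.1 hvr, fun _ hle he => ?_⟩
      have h1 := H.height v hvr
      refine hv.2 hv.1 (by omega) ?_
      rwa [show h v - h u = (h (p v) - h u) + 1 by omega, Function.iterate_succ_apply]
  have hcard : (S \ B).card + B.card = m := by
    rw [← hm]
    exact Finset.card_sdiff_add_card_eq_card (Finset.filter_subset _ _)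
  by_cases hsmall : (S \ B).card ≤ s
  · refine ⟨{u}, by simpa using huS, Or.inl (by simp), fun v hv => ⟨u, by simp, ?_⟩⟩
    by_cases hvB : v ∈ B
    · exact hBdist v hvB
    have hpu : p u ∈ S \ B := by
      simp only [B, Finset.mem_sdiff, Finset.mem_filter, not_and]
      refine ⟨hS.parent_mem u huS hur, fun _ hle => ?_⟩
      have := H.height u hur
      omega
    have h1 := H.dist_lt_card hG _ rfl hS' (p u) hpu v (Finset.mem_sdiff.2 ⟨hv, hvB⟩)
    have h2 := dist_eq_one_iff_adj.2 (H.adj u hur)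
    have h3 := hG.dist_triangle (u := u) (v := p u) (w := v)
    omega
  · obtain ⟨D, hDS, hD, hdom⟩ := ih (S \ B).card (by omega) rfl hS'
    refine ⟨insert u D, ?_, Or.inr ?_, fun v hv => ?_⟩
    · exact Finset.insert_subset huS (hDS.trans Finset.sdiff_subset)
    · have h1 := Finset.card_insert_le u D
      have h2 : D.card * (s + 1) ≤ (S \ B).card := by
        rcases hD with hD | hD
        · rw [hD]; omega
        · exact hD
      nlinarith
    · by_cases hvB : v ∈ B
      · exact ⟨u, Finset.mem_insert_self _ _, hBdist v hvB⟩
      · obtain ⟨d, hd, hdv⟩ := hdom v (Finset.mem_sdiff.2 ⟨hv, hvB⟩)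
        exact ⟨d, Finset.mem_insert_of_mem hd, hdv⟩

end IsRootedTree

/-- Meir and Moon: a connected graph on `m` vertices has a distance-`s` dominating set with at most
`m / (s + 1)` vertices, or with one vertex. -/
theorem Connected.exists_dominating [Fintype V] (hG : G.Connected) (s : ℕ) :
    ∃ D : Finset V, (D.card = 1 ∨ D.card * (s + 1) ≤ Fintype.card V) ∧
      ∀ v, ∃ d ∈ D, G.dist d v ≤ s := by
  obtain ⟨r⟩ := hG.nonempty
  obtain ⟨p, h, H⟩ := hG.exists_isRootedTree r
  obtain ⟨D, -, hD, hdom⟩ := H.exists_dominating hG s _ rfl (S := Finset.univ)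
    ⟨Finset.mem_univ _, fun _ _ _ => Finset.mem_univ _⟩
  exact ⟨D, hD, fun v => hdom v (Finset.mem_univ v)⟩

/-- Two vertices are adjacent if they have a common neighbour in `G`. -/
def commonNeighborGraph (G : SimpleGraph V) : SimpleGraph V where
  Adj a b := a ≠ b ∧ ∃ c, G.Adj a c ∧ G.Adj c b
  symm := ⟨fun _ _ ⟨hne, c, h1, h2⟩ => ⟨hne.symm, c, h2.symm, h1.symm⟩⟩
  loopless := ⟨fun _ h => h.1 rfl⟩

/-- A maximal independent set can be grown from one vertex by adding vertices at distance exactly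
two from it. -/
lemma Connected.exists_isIndepSet [Finite V] (hG : G.Connected) :
    ∃ M : Set V, G.IsIndepSet M ∧ (G.commonNeighborGraph.induce M).Connected ∧
      ∀ v, ∃ a ∈ M, G.dist a v ≤ 1 := by
  obtain ⟨r⟩ := hG.nonempty
  let P : Set (Set V) := {M | G.IsIndepSet M ∧ (G.commonNeighborGraph.induce M).Connected}
  have hP : ({r} : Set V) ∈ P := by
    refine ⟨Set.pairwise_singleton _ _, ?_⟩
    have : Unique ({r} : Set V) := Set.uniqueSingleton r
    have : Nonempty ({r} : Set V) := ⟨default⟩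
    exact ⟨fun a b => by rw [Subsingleton.elim a b]⟩
  obtain ⟨M, hM⟩ := P.toFinite.exists_maximal ⟨_, hP⟩
  obtain ⟨⟨hind, hconn⟩, hmax⟩ := hM
  refine ⟨M, hind, hconn, ?_⟩
  by_contra! hfar
  obtain ⟨v, hv⟩ := hfar
  obtain ⟨⟨m, hm⟩⟩ := hconn.nonempty
  -- An edge leaving the closed neighbourhood of `M`.
  obtain ⟨w⟩ := hG.preconnected m v
  obtain ⟨d, -, hd1, hd2⟩ := w.exists_boundary_dart {x | ∃ a ∈ M, G.dist a x ≤ 1}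
    ⟨m, hm, by simp⟩ (by simpa using hv)
  simp only [Set.mem_ofPred_eq, not_exists, not_and, not_le] at hd1 hd2
  obtain ⟨a, ha, had⟩ := hd1
  have hfM : d.snd ∉ M := fun h => by have := hd2 _ h; simp at this
  have had' : G.Adj a d.fst := by
    rcases Nat.le_one_iff_eq_zero_or_eq_one.1 had with h | h
    · rw [hG.dist_eq_zero_iff] at h
      have := hd2 a ha
      rw [h, dist_eq_one_iff_adj.2 d.adj] at this
      omega
    · exact dist_eq_one_iff_adj.1 h
  have hne : a ≠ d.snd := fun h => hfM (h ▸ ha)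
  have hins : insert d.snd M ∈ P := by
    constructor
    · have hnot : ∀ b ∈ M, ¬ G.Adj b d.snd := by
        intro b hb hadj
        have := hd2 b hb
        rw [dist_eq_one_iff_adj.2 hadj] at this
        omega
      exact Set.pairwise_insert.2 ⟨hind, fun b hb _ => ⟨fun h => hnot b hb h.symm, hnot b hb⟩⟩
    · have hadj : G.commonNeighborGraph.Adj a d.snd := ⟨hne, d.fst, had', d.adj⟩
      have hun : insert d.snd M = M ∪ {a, d.snd} := by
        ext x
        simp only [Set.mem_insert_iff, Set.mem_union, Set.mem_singleton_iff]
        constructor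
        · tauto
        · rintro (h | rfl | h)
          exacts [Or.inr h, Or.inr ha, Or.inl h]
      rw [hun]
      exact induce_union_connected hconn.preconnected
        (induce_pair_connected_of_adj hadj).preconnected ⟨a, ha, by simp⟩
  exact hfM (hmax hins (Set.subset_insert _ _) (Set.mem_insert _ _))

end SimpleGraph

/-! ### Berge paths -/

namespace Hypergraph

variable {α : Type*} {H : Hypergraph α}

lemma hasBergePath_zero {x : α} (hx : x ∈ H.vertexSet) : H.HasBergePath 0 x x :=
  ⟨fun _ => x, Fin.elim0, ⟨fun _ => hx, fun i => i.elim0, fun i => i.elim0, fun i => i.elim0⟩,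
    rfl, rfl⟩

lemma HasBergePath.eq_of_zero {x y : α} (h : H.HasBergePath 0 x y) : x = y := by
  obtain ⟨v, e, -, rfl, rfl⟩ := h
  rfl

lemma HasBergePath.snoc {n : ℕ} {x y z : α} (h : H.HasBergePath n x y) {e : Set α}
    (he : e ∈ H.edgeSet) (hy : y ∈ e) (hz : z ∈ e) : H.HasBergePath (n + 1) x z := by
  obtain ⟨v, f, hp, rfl, rfl⟩ := h
  refine ⟨Fin.snoc v z, Fin.snoc f e, ⟨?_, ?_, ?_, ?_⟩, ?_, ?_⟩
  · intro i
    refine Fin.lastCases ?_ (fun i => ?_) i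
    · simpa using H.mem_vertexSet_of_mem_edgeSet he hz
    · simpa using hp.vertex_mem i
  · intro i
    refine Fin.lastCases ?_ (fun i => ?_) i
    · simpa using he
    · simpa using hp.edge_mem i
  · intro i
    refine Fin.lastCases ?_ (fun i => ?_) i
    · simpa using hy
    · simpa using hp.left_mem i
  · intro i
    refine Fin.lastCases ?_ (fun i => ?_) i
    · simpa using hz
    · rw [← Fin.castSucc_succ]
      simpa only [Fin.snoc_castSucc] using hp.right_mem i
  · rw [← Fin.castSucc_zero, Fin.snoc_castSucc]
  · simp

lemma HasBergePath.exists_last {n : ℕ} {x z : α} (h : H.HasBergePath (n + 1) x z) :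
    ∃ y, ∃ e ∈ H.edgeSet, H.HasBergePath n x y ∧ y ∈ e ∧ z ∈ e := by
  obtain ⟨v, f, hp, rfl, rfl⟩ := h
  refine ⟨v (Fin.last n).castSucc, f (Fin.last n), hp.edge_mem _,
    ⟨fun i => v i.castSucc, fun i => f i.castSucc, ⟨fun i => hp.vertex_mem _,
      fun i => hp.edge_mem _, fun i => hp.left_mem _, fun i => ?_⟩, rfl, rfl⟩,
    hp.left_mem _, ?_⟩
  · simpa using hp.right_mem i.castSucc
  · simpa using hp.right_mem (Fin.last n)

lemma HasBergePath.trans {m n : ℕ} {x y z : α} (h : H.HasBergePath m x y)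
    (h' : H.HasBergePath n y z) : H.HasBergePath (m + n) x z := by
  induction n generalizing z with
  | zero => exact h'.eq_of_zero ▸ h
  | succ n ih =>
    obtain ⟨w, e, he, hw, hwe, hze⟩ := h'.exists_last
    exact (ih hw).snoc he hwe hze

lemma hasBergePath_one {x y : α} {e : Set α} (he : e ∈ H.edgeSet) (hx : x ∈ e) (hy : y ∈ e) :
    H.HasBergePath 1 x y :=
  (hasBergePath_zero (H.mem_vertexSet_of_mem_edgeSet he hx)).snoc he hx hy

lemma HasBergePath.symm {n : ℕ} {x y : α} (h : H.HasBergePath n x y) : H.HasBergePath n y x := by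
  induction n generalizing y with
  | zero =>
    obtain rfl := h.eq_of_zero
    exact h
  | succ n ih =>
    obtain ⟨w, e, he, hw, hwe, hye⟩ := h.exists_last
    rw [add_comm]
    exact (hasBergePath_one he hye hwe).trans (ih hw)

lemma bergeDist_le_iff {l : ℕ} {x y : α} :
    H.bergeDist x y ≤ l ↔ ∃ n ≤ l, H.HasBergePath n x y := by
  constructor
  · intro h
    by_contra! hno
    have : ((l + 1 : ℕ) : ℕ∞) ≤ H.bergeDist x y :=
      le_iInf₂ fun n hn => by
        have : l + 1 ≤ n := by
          by_contra hlt
          exact hno n (by omega) hn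
        exact_mod_cast this
    have := this.trans h
    norm_cast at this
    omega
  · rintro ⟨n, hn, h⟩
    exact (iInf₂_le n h).trans (by exact_mod_cast hn)

lemma isDistDominating_iff {l : ℕ} {D : Set α} : H.IsDistDominating l D ↔
    D ⊆ H.vertexSet ∧ ∀ y ∈ H.vertexSet, ∃ x ∈ D, ∃ n ≤ l, H.HasBergePath n x y := by
  refine and_congr_right fun _ => ?_
  rw [Set.Subset.antisymm_iff, and_iff_right]
  · simp only [Set.subset_def, Set.mem_iUnion, bergeBall, Set.mem_ofPred_eq, bergeDist_le_iff]
    exact ⟨fun h y hy => by simpa [hy] using h y hy, fun h y hy => by simpa [hy] using h y hy⟩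
  · simp only [Set.iUnion_subset_iff]
    exact fun x _ y hy => hy.1

lemma le_encard_of_isDistDominating {γ l : ℕ} (hγ : (γ : ℕ∞) ≤ H.distDomNumber l) {D : Set α}
    (hD : H.IsDistDominating l D) : (γ : ℕ∞) ≤ D.encard :=
  hγ.trans (iInf₂_le D hD)

/-- If one vertex does not dominate, every vertex has another one at distance more than `l`. -/
lemma exists_far {γ l : ℕ} (h2 : 2 ≤ γ) (hγ : (γ : ℕ∞) ≤ H.distDomNumber l) {x : α}
    (hx : x ∈ H.vertexSet) : ∃ y ∈ H.vertexSet, ∀ n ≤ l, ¬ H.HasBergePath n x y := by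
  by_contra! hno
  have := le_encard_of_isDistDominating hγ (D := {x})
    (isDistDominating_iff.2 ⟨by simpa using hx, fun y hy => ⟨x, rfl, hno y hy⟩⟩)
  rw [Set.encard_singleton] at this
  norm_cast at this
  omega

lemma IsBergeConnected.exists_edge {γ l : ℕ} (hc : H.IsBergeConnected) (h2 : 2 ≤ γ)
    (hγ : (γ : ℕ∞) ≤ H.distDomNumber l) {x : α} (hx : x ∈ H.vertexSet) :
    ∃ e ∈ H.edgeSet, x ∈ e := by
  obtain ⟨y, hy, hxy⟩ := exists_far h2 hγ hx
  obtain ⟨n, hn⟩ := hc.2 y hy x hx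
  rcases n with _ | n
  · obtain rfl := hn.eq_of_zero
    exact absurd hn (hxy 0 (by omega))
  · obtain ⟨_, e, he, -, -, hxe⟩ := hn.exists_last
    exact ⟨e, he, hxe⟩

/-! ### The intersection graph and the lower bounds -/

/-- The intersection graph of the edges of a hypergraph. -/
def intersectionGraph (H : Hypergraph α) : SimpleGraph H.edgeSet where
  Adj e f := e ≠ f ∧ ((e : Set α) ∩ f).Nonempty
  symm := ⟨fun _ _ h => ⟨h.1.symm, by rw [Set.inter_comm]; exact h.2⟩⟩
  loopless := ⟨fun _ h => h.1 rfl⟩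

lemma hasBergePath_of_walk {e f : H.edgeSet} (w : H.intersectionGraph.Walk e f) {x y : α}
    (hx : x ∈ (e : Set α)) (hy : y ∈ (f : Set α)) : H.HasBergePath (w.length + 1) x y := by
  induction w generalizing x with
  | nil => exact hasBergePath_one (Subtype.property _) hx hy
  | @cons e g f h w ih =>
    obtain ⟨z, hze, hzg⟩ := h.2
    have := (hasBergePath_one e.2 hx hze).trans (ih hzg hy)
    rwa [SimpleGraph.Walk.length_cons, add_comm]

lemma HasBergePath.reachable {n : ℕ} {x y : α} (h : H.HasBergePath n x y) {e f : H.edgeSet}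
    (hx : x ∈ (e : Set α)) (hy : y ∈ (f : Set α)) : H.intersectionGraph.Reachable e f := by
  have hmeet : ∀ {e f : H.edgeSet} {z : α}, z ∈ (e : Set α) → z ∈ (f : Set α) →
      H.intersectionGraph.Reachable e f := by
    intro e f z he hf
    by_cases hef : e = f
    · rw [hef]
    · exact SimpleGraph.Adj.reachable ⟨hef, z, he, hf⟩
  induction n generalizing y f with
  | zero =>
    obtain rfl := h.eq_of_zero
    exact hmeet hx hy
  | succ n ih =>
    obtain ⟨z, g, hg, hz, hzg, hyg⟩ := h.exists_last
    exact (ih hz (f := ⟨g, hg⟩) hzg).trans (hmeet hyg hy)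

lemma IsUniform.nonempty {k : ℕ} (hu : H.IsUniform k) (hk : 1 ≤ k) (e : H.edgeSet) :
    (e : Set α).Nonempty := by
  rw [← Set.encard_pos, hu e e.2]
  exact_mod_cast hk

lemma IsBergeConnected.connected_intersectionGraph {k γ l : ℕ} (hc : H.IsBergeConnected)
    (hu : H.IsUniform k) (hk : 1 ≤ k) (h2 : 2 ≤ γ) (hγ : (γ : ℕ∞) ≤ H.distDomNumber l) :
    H.intersectionGraph.Connected := by
  obtain ⟨x, hx⟩ := hc.1
  obtain ⟨e, he, -⟩ := hc.exists_edge h2 hγ hx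
  have : Nonempty H.edgeSet := ⟨⟨e, he⟩⟩
  refine ⟨fun e f => ?_⟩
  obtain ⟨x, hx⟩ := hu.nonempty hk e
  obtain ⟨y, hy⟩ := hu.nonempty hk f
  obtain ⟨n, hn⟩ := hc.2 x (H.mem_vertexSet_of_mem_edgeSet e.2 hx) y
    (H.mem_vertexSet_of_mem_edgeSet f.2 hy)
  exact hn.reachable hx hy

/-- Double counting: if every vertex lies in at most `t` edges of `S`, then `|S| k ≤ n t`. -/
lemma IsUniform.card_mul_le {k n t : ℕ} (hu : H.IsUniform k) (hn : H.vertexSet.encard = n)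
    (S : Finset H.edgeSet)
    (hS : ∀ T ⊆ S, ∀ x, (∀ e ∈ T, x ∈ (e : Set α)) → T.card ≤ t) : S.card * k ≤ n * t := by
  classical
  have hfin : H.vertexSet.Finite := Set.finite_of_encard_eq_coe hn
  have hcard : hfin.toFinset.card = n := by
    rw [hfin.encard_eq_coe_toFinset_card] at hn
    exact_mod_cast hn
  rw [← hcard]
  refine Finset.card_mul_le_card_mul (fun (e : H.edgeSet) (x : α) => x ∈ (e : Set α))
    (fun e _ => ?_) fun x _ => ?_
  · have h1 : ((hfin.toFinset.bipartiteAbove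
        (fun (e : H.edgeSet) (x : α) => x ∈ (e : Set α)) e : Finset α) : Set α)
        = e := by
      ext x
      simp only [Finset.bipartiteAbove, Finset.coe_filter, Set.Finite.mem_toFinset,
        Set.mem_ofPred_eq, and_iff_right_iff_imp]
      exact H.mem_vertexSet_of_mem_edgeSet e.2
    have h2 := hu e e.2
    rw [← h1, Set.encard_coe_eq_coe_finsetCard] at h2
    exact_mod_cast h2.ge
  · refine hS _ (Finset.filter_subset _ _) x fun e he => ?_
    exact (Finset.mem_filter.1 he).2

lemma finite_edgeSet {n : ℕ} (hn : H.vertexSet.encard = n) : Finite H.edgeSet :=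
  ((Set.finite_of_encard_eq_coe hn).finite_subsets.subset
    fun _ he => H.subset_vertexSet_of_mem_edgeSet he).to_subtype

/-- Among the edges there are `2 l + 1` of which no three have a common vertex. -/
theorem mul_le_of_mem_distConnOrders_two {k l n : ℕ} (hk : 1 ≤ k) (hl : 2 ≤ l)
    (h : n ∈ distConnOrders k 2 l) : (2 * l + 1) * k ≤ 2 * n := by
  obtain ⟨α, H, hn, hu, hc, hγ⟩ := h
  have := finite_edgeSet hn
  have hG := hc.connected_intersectionGraph hu hk le_rfl hγ
  obtain ⟨l, rfl⟩ : ∃ m, l = m + 1 := ⟨l - 1, by omega⟩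
  -- An edge containing a vertex far from `x` is far from every edge containing `x`.
  have hfar : ∀ x ∈ H.vertexSet, ∃ g : H.edgeSet, ∀ e : H.edgeSet, x ∈ (e : Set α) →
      l + 1 ≤ H.intersectionGraph.dist e g := by
    intro x hx
    obtain ⟨y, hy, hxy⟩ := exists_far le_rfl hγ hx
    obtain ⟨g, hg, hyg⟩ := hc.exists_edge le_rfl hγ hy
    refine ⟨⟨g, hg⟩, fun e he => ?_⟩
    by_contra hlt
    obtain ⟨w, hw⟩ := hG.exists_walk_length_eq_dist e ⟨g, hg⟩
    exact hxy _ (by omega) (hasBergePath_of_walk w he hyg)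
  have hr : H.intersectionGraph.EdgeRadiusGE (l + 1) := by
    rintro e f ⟨-, x, hxe, hxf⟩
    obtain ⟨g, hg⟩ := hfar x (H.mem_vertexSet_of_mem_edgeSet e.2 hxe)
    exact ⟨g, hg e hxe, hg f hxf⟩
  have hnt : Nontrivial H.edgeSet := by
    obtain ⟨x, hx⟩ := hc.1
    obtain ⟨e, he, hxe⟩ := hc.exists_edge le_rfl hγ hx
    obtain ⟨g, hg⟩ := hfar x hx
    refine ⟨⟨e, he⟩, g, fun heq => ?_⟩
    have := hg ⟨e, he⟩ hxe
    rw [heq, SimpleGraph.dist_self] at this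
    omega
  obtain ⟨S, hS, hST⟩ := hr.exists_triangleFreeOn (by omega) hG
  have := hu.card_mul_le (t := 2) hn S fun T hTS x hx => ?_
  · rw [hS] at this
    linarith
  · by_contra! hT
    obtain ⟨a, ha, b, hb, c, hc, hab, hac, hbc⟩ := Finset.two_lt_card.1 hT
    exact hST a (hTS ha) b (hTS hb) c (hTS hc) ⟨hab, x, hx a ha, hx b hb⟩
      ⟨hbc, x, hx b hb, hx c hc⟩ ⟨hac, x, hx a ha, hx c hc⟩

/-- Vertices chosen from the edges in a distance-`s` dominating set of the graph on a maximal
matching dominate the hypergraph within distance `2 s + 2`. -/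
theorem mul_le_of_mem_distConnOrders {k γ l s n : ℕ} (hk : 1 ≤ k) (h2 : 2 ≤ γ)
    (hs : 2 * (s + 1) ≤ l) (h : n ∈ distConnOrders k γ l) : γ * (s + 1) * k ≤ n := by
  classical
  obtain ⟨α, H, hn, hu, hc, hγ⟩ := h
  have := finite_edgeSet hn
  have hG := hc.connected_intersectionGraph hu hk h2 hγ
  obtain ⟨M, hind, hM, hmax⟩ := hG.exists_isIndepSet
  have := Fintype.ofFinite M
  obtain ⟨D, hD, hdom⟩ := hM.exists_dominating s
  -- A step in the graph on `M` is two steps in the intersection graph.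
  have hdist : ∀ {a b : M}
      (w : (H.intersectionGraph.commonNeighborGraph.induce M).Walk a b),
      H.intersectionGraph.dist (a : H.edgeSet) b ≤ 2 * w.length := by
    intro a b w
    induction w with
    | nil => simp
    | @cons a c b hac w ih =>
      obtain ⟨-, d, had, hdc⟩ : H.intersectionGraph.commonNeighborGraph.Adj a c := id hac
      have h1 := SimpleGraph.dist_eq_one_iff_adj.2 had
      have h2 := SimpleGraph.dist_eq_one_iff_adj.2 hdc
      have h3 := hG.dist_triangle (u := (a : H.edgeSet)) (v := d) (w := b)
      have h4 := hG.dist_triangle (u := d) (v := (c : H.edgeSet)) (w := b)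
      rw [SimpleGraph.Walk.length_cons]
      omega
  choose q hq using fun e : H.edgeSet => hu.nonempty hk e
  have hdom' : H.IsDistDominating l (D.image fun e : M => q e : Finset α) := by
    rw [isDistDominating_iff]
    constructor
    · intro x hx
      simp only [Finset.coe_image, Set.mem_image] at hx
      obtain ⟨e, -, rfl⟩ := hx
      exact H.mem_vertexSet_of_mem_edgeSet (e : H.edgeSet).2 (hq e)
    · intro y hy
      obtain ⟨f, hf, hyf⟩ := hc.exists_edge h2 hγ hy
      obtain ⟨a, ha, haf⟩ := hmax ⟨f, hf⟩
      obtain ⟨d, hd, hda⟩ := hdom ⟨a, ha⟩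
      obtain ⟨w, hw⟩ := hM.exists_walk_length_eq_dist d ⟨a, ha⟩
      have h1 := hdist w
      simp only at h1
      have h3 := hG.dist_triangle (u := (d : H.edgeSet)) (v := a) (w := ⟨f, hf⟩)
      obtain ⟨w', hw'⟩ := hG.exists_walk_length_eq_dist (d : H.edgeSet) ⟨f, hf⟩
      refine ⟨q d, Finset.mem_coe.2 (Finset.mem_image.2 ⟨d, hd, rfl⟩), _, ?_,
        hasBergePath_of_walk w' (hq d) hyf⟩
      omega
  have hle := le_encard_of_isDistDominating hγ hdom'
  rw [Set.encard_coe_eq_coe_finsetCard] at hle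
  have hγD : γ ≤ D.card := le_trans (by exact_mod_cast hle) Finset.card_image_le
  have hDM : γ * (s + 1) ≤ Fintype.card M := by
    rcases hD with hD | hD
    · omega
    · exact (Nat.mul_le_mul_right _ hγD).trans hD
  have hcount := hu.card_mul_le (t := 1) hn M.toFinset fun T hT x hx => ?_
  · rw [Set.toFinset_card, mul_one] at hcount
    exact (Nat.mul_le_mul_right k hDM).trans hcount
  · refine Finset.card_le_one.2 fun a ha b hb => ?_
    by_contra hab
    exact hind (Set.mem_toFinset.1 (hT ha)) (Set.mem_toFinset.1 (hT hb)) hab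
      ⟨hab, x, hx a ha, hx b hb⟩

end Hypergraph

/-! ### Spiders -/

namespace Hypergraph

variable {α : Type*} {H : Hypergraph α}

lemma encard_range_of_injective {ι : Type*} {f : ι → α} (hf : Function.Injective f) :
    (Set.range f).encard = ENat.card ι := by
  rw [← Set.image_univ, hf.encard_image, Set.encard_univ]

/-- A potential changing by at most one along each edge bounds lengths of Berge paths. -/
lemma HasBergePath.le_add {φ : α → ℕ}
    (hφ : ∀ e ∈ H.edgeSet, ∀ x ∈ e, ∀ y ∈ e, φ x ≤ φ y + 1) {n : ℕ} {x y : α}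
    (h : H.HasBergePath n x y) : φ x ≤ φ y + n := by
  induction n generalizing y with
  | zero => rw [h.eq_of_zero]; omega
  | succ n ih =>
    obtain ⟨z, e, he, hz, hze, hye⟩ := h.exists_last
    have := ih hz
    have := hφ e he z hze y hye
    omega

/-- The size of the layer at height `t` of an arm. Two consecutive layers form an edge. -/
def armSize (k t : ℕ) : ℕ := if Even t then 1 else k - 1

lemma armSize_add_succ {k : ℕ} (hk : 1 ≤ k) (t : ℕ) : armSize k t + armSize k (t + 1) = k := by
  unfold armSize
  by_cases h : Even t <;> simp [h, Nat.even_add_one] <;> omega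

lemma armSize_pos {k : ℕ} (hk : 2 ≤ k) (t : ℕ) : 0 < armSize k t := by
  unfold armSize
  split_ifs <;> omega

lemma sum_armSize_two_mul {k : ℕ} (hk : 1 ≤ k) (m : ℕ) :
    ∑ t ∈ Finset.range (2 * m), armSize k t = m * k := by
  induction m with
  | zero => simp
  | succ m ih =>
    rw [show 2 * (m + 1) = 2 * m + 1 + 1 by ring, Finset.sum_range_succ, Finset.sum_range_succ, ih,
      add_assoc, armSize_add_succ hk]
    ring

/-- The vertices of the spider hypergraph: `γ` arms with layers at heights `0, …, l`, and `ε`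
further vertices. -/
abbrev SpiderVertex (k γ l ε : ℕ) : Type :=
  (Fin γ × Σ t : Fin (l + 1), Fin (armSize k t)) ⊕ Fin ε

namespace SpiderVertex

variable {k γ l ε : ℕ}

/-- The layer of the `i`-th arm at height `t`. -/
def layer (i : Fin γ) (t : Fin (l + 1)) : Set (SpiderVertex k γ l ε) :=
  Set.range fun j => Sum.inl (i, ⟨t, j⟩)

/-- The height of a vertex above the tip of its arm; the vertices outside the arms count as lying at
height `l`. -/
def height : SpiderVertex k γ l ε → ℕ
  | Sum.inl (_, ⟨t, _⟩) => t
  | Sum.inr _ => l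

/-- The distance to the tip of the `i`-th arm, truncated at `l + 1`. -/
def potential (i : Fin γ) : SpiderVertex k γ l ε → ℕ
  | Sum.inl (i', ⟨t, _⟩) => if i' = i then t else l + 1
  | Sum.inr _ => l + 1

/-- The hub: the top layers of all arms, and the vertices outside the arms. -/
def hub : Set (SpiderVertex k γ l ε) := {x | x.height = l}

lemma encard_layer (i : Fin γ) (t : Fin (l + 1)) :
    (layer i t : Set (SpiderVertex k γ l ε)).encard = armSize k t := by
  have : Function.Injective
      fun j : Fin (armSize k t) => (Sum.inl (i, ⟨t, j⟩) : SpiderVertex k γ l ε) := by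
    intro a b h
    simpa using h
  rw [layer, encard_range_of_injective this]
  simp

lemma encard_layer_union (hk : 1 ≤ k) (i : Fin γ) (t : Fin l) :
    (layer i t.castSucc ∪ layer i t.succ : Set (SpiderVertex k γ l ε)).encard = k := by
  rw [Set.encard_union_eq, encard_layer, encard_layer]
  · have := armSize_add_succ hk t
    simp only [Fin.val_castSucc, Fin.val_succ]
    exact_mod_cast this
  · rw [Set.disjoint_left]
    rintro _ ⟨a, rfl⟩ ⟨b, hb⟩
    simp only [Sum.inl.injEq, Prod.mk.injEq, Sigma.mk.injEq, true_and] at hb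
    exact (Fin.castSucc_lt_succ (i := t)).ne' hb.1

lemma le_encard_hub :
    ((γ * armSize k l + ε : ℕ) : ℕ∞) ≤ (hub : Set (SpiderVertex k γ l ε)).encard := by
  let f : (Fin γ × Fin (armSize k l)) ⊕ Fin ε → SpiderVertex k γ l ε :=
    Sum.map (fun p => (p.1, ⟨Fin.last l, p.2⟩)) id
  have hf : Function.Injective f := by
    refine Sum.map_injective.2 ⟨?_, Function.injective_id⟩
    rintro ⟨a, b⟩ ⟨c, d⟩ h
    simpa using h
  have hsub : Set.range f ⊆ hub := by
    rintro _ ⟨⟨a, b⟩ | a, rfl⟩ <;> simp [f, hub, height]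
  refine le_trans ?_ (Set.encard_le_encard hsub)
  rw [encard_range_of_injective hf]
  simp

end SpiderVertex

open SpiderVertex

/-- The spider hypergraph: the edges are the unions of two consecutive layers of an arm, and all
`k`-subsets of the hub. -/
def spider (k γ l ε : ℕ) : Hypergraph (SpiderVertex k γ l ε) where
  vertexSet := Set.univ
  edgeSet := {e | (∃ i, ∃ t : Fin l, e = layer i t.castSucc ∪ layer i t.succ) ∨
    (e ⊆ hub ∧ e.encard = k)}
  subset_vertexSet_of_mem_edgeSet' _ _ := Set.subset_univ _

lemma spider_potential_le {k γ l ε : ℕ} (i : Fin γ) :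
    ∀ e ∈ (spider k γ l ε).edgeSet, ∀ x ∈ e, ∀ y ∈ e, potential i x ≤ potential i y + 1 := by
  rintro e (⟨i', t, rfl⟩ | ⟨he, -⟩) x hx y hy
  · rcases hx with ⟨a, rfl⟩ | ⟨a, rfl⟩ <;> rcases hy with ⟨b, rfl⟩ | ⟨b, rfl⟩ <;>
      simp only [potential, Fin.val_castSucc, Fin.val_succ] <;> split_ifs <;> omega
  · have key : ∀ x ∈ e, l ≤ potential i x ∧ potential i x ≤ l + 1 := by
      intro x hx
      have := he hx
      rcases x with ⟨i', t, j⟩ | j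
      · simp only [hub, height, Set.mem_ofPred_eq] at this
        simp only [potential]
        split_ifs <;> omega
      · simp [potential]
    have := key x hx
    have := key y hy
    omega

lemma spider_exists_path_hub {k γ l ε : ℕ} (hk : 2 ≤ k) (x : SpiderVertex k γ l ε) :
    ∃ y ∈ hub, ∃ n, (spider k γ l ε).HasBergePath n x y := by
  induction hm : l - x.height using Nat.strong_induction_on generalizing x with
  | _ m ih =>
  rcases x with ⟨i, t, j⟩ | j
  · rcases Fin.eq_castSucc_or_eq_last t with ⟨t, rfl⟩ | rfl
    · let z : SpiderVertex k γ l ε := Sum.inl (i, ⟨t.succ, ⟨0, armSize_pos hk _⟩⟩)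
      have hstep : (spider k γ l ε).HasBergePath 1 (Sum.inl (i, ⟨t.castSucc, j⟩)) z :=
        hasBergePath_one (Or.inl ⟨i, t, rfl⟩) (Or.inl ⟨j, rfl⟩) (Or.inr ⟨_, rfl⟩)
      obtain ⟨y, hy, n, hn⟩ := ih (l - z.height)
        (by simp only [z, height, Fin.val_succ, Fin.val_castSucc] at hm ⊢; omega) z rfl
      exact ⟨y, hy, _, hstep.trans hn⟩
    · exact ⟨_, by simp [hub, height], 0, hasBergePath_zero (Set.mem_univ _)⟩
  · exact ⟨_, by simp [hub, height], 0, hasBergePath_zero (Set.mem_univ _)⟩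

/-- A spider whose hub is large enough to be connected has distance-`l` domination number at least
`γ`, as each arm needs a dominating vertex of its own. -/
theorem spider_mem_distConnOrders {k γ l ε : ℕ} (hk : 2 ≤ k) (hγ : 1 ≤ γ)
    (hhub : k ≤ γ * armSize k l + ε) :
    γ * ∑ t ∈ Finset.range (l + 1), armSize k t + ε ∈ distConnOrders k γ l := by
  let tip : Fin γ → SpiderVertex k γ l ε := fun i => Sum.inl (i, ⟨0, ⟨0, armSize_pos hk _⟩⟩)
  refine ⟨SpiderVertex k γ l ε, spider k γ l ε, ?_, ?_, ⟨?_, ?_⟩, ?_⟩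
  · rw [spider, Set.encard_univ, ENat.card_eq_coe_fintype_card]
    simp [Fin.sum_univ_eq_sum_range (armSize k)]
  · rintro e (⟨i, t, rfl⟩ | ⟨-, he⟩)
    · exact encard_layer_union (by omega) i t
    · exact he
  · exact ⟨tip ⟨0, hγ⟩, Set.mem_univ _⟩
  · intro x _ y _
    obtain ⟨x', hx', m, hm⟩ := spider_exists_path_hub hk x
    obtain ⟨y', hy', n, hn⟩ := spider_exists_path_hub hk y
    obtain ⟨e, hxye, he, hek⟩ := Set.exists_superset_subset_encard_eq (s := {x', y'}) (k := k)
      (Set.insert_subset hx' (Set.singleton_subset_iff.2 hy'))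
      ((Set.encard_insert_le _ _).trans (by
        rw [Set.encard_singleton, one_add_one_eq_two]; exact_mod_cast hk))
      (le_trans (by exact_mod_cast hhub) le_encard_hub)
    have hstep : (spider k γ l ε).HasBergePath 1 x' y' :=
      hasBergePath_one (Or.inr ⟨he, hek⟩) (hxye (by simp)) (hxye (by simp))
    exact ⟨_, (hm.trans hstep).trans hn.symm⟩
  · -- The tip of each arm is dominated by a vertex of the same arm only.
    refine le_iInf₂ fun D hD => ?_
    rw [isDistDominating_iff] at hD
    choose d hdD n hn hd using fun i => hD.2 (tip i) (Set.mem_univ _)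
    have howner : ∀ i, ∃ s, d i = Sum.inl (i, s) := by
      intro i
      have h1 := (hd i).le_add (spider_potential_le i)
      have h2 := hn i
      have h3 : potential i (tip i) = 0 := by simp [tip, potential]
      rcases hdi : d i with ⟨i', t, j⟩ | j
      · rw [hdi, h3] at h1
        simp only [potential] at h1
        split_ifs at h1 with hi
        · exact ⟨⟨t, j⟩, by rw [hi]⟩
        · omega
      · rw [hdi, h3] at h1
        simp only [potential] at h1
        omega
    have hinj : Function.Injective d := by
      intro i i' h
      obtain ⟨s, hs⟩ := howner i
      obtain ⟨s', hs'⟩ := howner i'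
      rw [hs, hs', Sum.inl.injEq, Prod.mk.injEq] at h
      exact h.1
    have hle := Set.encard_le_encard (Set.range_subset_iff.2 hdD)
    rw [encard_range_of_injective hinj] at hle
    simpa using hle

theorem two_mul_mem_distConnOrders {k γ : ℕ} (hk : 2 ≤ k) (hγ : 1 ≤ γ) (m : ℕ) :
    m * k * γ + max k γ ∈ distConnOrders k γ (2 * m) := by
  have hsize : armSize k (2 * m) = 1 := by simp [armSize]
  have h := spider_mem_distConnOrders (l := 2 * m) (ε := max k γ - γ) hk hγ
    (by rw [hsize]; omega)
  rw [Finset.sum_range_succ, sum_armSize_two_mul (by omega), hsize] at h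
  convert h using 1
  have : γ + (max k γ - γ) = max k γ := by omega
  rw [← this]
  ring_nf
  omega

theorem two_mul_add_one_mem_distConnOrders {k γ : ℕ} (hk : 2 ≤ k) (hγ : 2 ≤ γ) (m : ℕ) :
    (m + 1) * k * γ ∈ distConnOrders k γ (2 * m + 1) := by
  have hsize : armSize k (2 * m + 1) = k - 1 := by simp [armSize]
  have h := spider_mem_distConnOrders (γ := γ) (l := 2 * m + 1) (ε := 0) hk (by omega)
    (by rw [hsize]; have := Nat.mul_le_mul_right (k - 1) hγ; omega)
  rw [show 2 * m + 1 + 1 = 2 * (m + 1) by ring, sum_armSize_two_mul (by omega)] at h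
  convert h using 1
  ring

end Hypergraph

/-! ### Cycles of edges -/

namespace Hypergraph

variable {α : Type*} {H : Hypergraph α}

lemma two_le_distDomNumber {l : ℕ} (hne : H.vertexSet.Nonempty)
    (hfar : ∀ x ∈ H.vertexSet, ∃ y ∈ H.vertexSet, ∀ n ≤ l, ¬ H.HasBergePath n x y) :
    ((2 : ℕ) : ℕ∞) ≤ H.distDomNumber l := by
  refine le_iInf₂ fun D hD => ?_
  rw [isDistDominating_iff] at hD
  obtain ⟨v, hv⟩ := hne
  obtain ⟨x, hx, -⟩ := hD.2 v hv
  obtain ⟨y, hy, hxy⟩ := hfar x (hD.1 hx)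
  obtain ⟨z, hz, n, hn, hzy⟩ := hD.2 y hy
  have hxz : x ≠ z := by
    rintro rfl
    exact hxy n hn hzy
  have := Set.encard_le_encard (Set.insert_subset hx (Set.singleton_subset_iff.2 hz))
  rwa [Set.encard_pair hxz] at this

/-- The vertices of a hypergraph whose edges `E i` form a cycle: `c i` vertices shared by `E (i - 1)`
and `E i`, and `p i` vertices private to `E i`. -/
abbrev CycleVertex {N : ℕ} (c p : ZMod N → ℕ) : Type :=
  (Σ i, Fin (c i)) ⊕ (Σ i, Fin (p i))

namespace CycleVertex

variable {N : ℕ} {c p : ZMod N → ℕ}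

/-- The `i`-th edge of the cycle. -/
def edge (i : ZMod N) : Set (CycleVertex c p) :=
  (Set.range fun a => Sum.inl ⟨i, a⟩) ∪ (Set.range fun a => Sum.inl ⟨i + 1, a⟩) ∪
    Set.range fun a => Sum.inr ⟨i, a⟩

/-- The index of a vertex: it lies in the edge of this index, and perhaps in the one before. -/
def index : CycleVertex c p → ZMod N
  | Sum.inl ⟨i, _⟩ => i
  | Sum.inr ⟨i, _⟩ => i

lemma mem_edge_index (x : CycleVertex c p) : x ∈ edge (index x) := by
  rcases x with ⟨i, a⟩ | ⟨i, a⟩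
  · exact Or.inl (Or.inl ⟨a, rfl⟩)
  · exact Or.inr ⟨a, rfl⟩

lemma index_eq_of_mem {x : CycleVertex c p} {i : ZMod N} (hx : x ∈ edge i) :
    index x = i ∨ index x = i + 1 := by
  rcases hx with (⟨a, rfl⟩ | ⟨a, rfl⟩) | ⟨a, rfl⟩
  exacts [Or.inl rfl, Or.inr rfl, Or.inl rfl]

lemma eq_of_inr_mem {j i : ZMod N} {a : Fin (p j)}
    (h : (Sum.inr ⟨j, a⟩ : CycleVertex c p) ∈ edge i) : j = i := by
  rcases h with (⟨b, hb⟩ | ⟨b, hb⟩) | ⟨b, hb⟩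
  · cases hb
  · cases hb
  · cases hb
    rfl

lemma encard_edge (h1 : (1 : ZMod N) ≠ 0) (i : ZMod N) :
    (edge i : Set (CycleVertex c p)).encard = (c i + c (i + 1) + p i : ℕ) := by
  have hl : ∀ i, Function.Injective fun a => (Sum.inl ⟨i, a⟩ : CycleVertex c p) := by
    intro i a b h
    simpa using h
  have hr : ∀ i, Function.Injective fun a => (Sum.inr ⟨i, a⟩ : CycleVertex c p) := by
    intro i a b h
    simpa using h
  rw [edge, Set.encard_union_eq, Set.encard_union_eq, encard_range_of_injective (hl _),
    encard_range_of_injective (hl _),    encard_range_of_injective (hr _)]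
  · simp
  · rw [Set.disjoint_left]
    rintro _ ⟨a, rfl⟩ ⟨b, hb⟩
    simp only [Sum.inl.injEq, Sigma.mk.injEq] at hb
    exact h1 (by simpa using hb.1)
  · rw [Set.disjoint_left]
    rintro _ (⟨a, rfl⟩ | ⟨a, rfl⟩) ⟨b, hb⟩ <;> cases hb

end CycleVertex

open CycleVertex

/-- The hypergraph whose edges form a cycle of length `N`. -/
def cycleHypergraph {N : ℕ} (c p : ZMod N → ℕ) : Hypergraph (CycleVertex c p) where
  vertexSet := Set.univ
  edgeSet := Set.range edge
  subset_vertexSet_of_mem_edgeSet' _ _ := Set.subset_univ _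

/-- After `n + 1` steps from `x`, the edges in use are among the `n + 1` edges before and after
`x`. -/
lemma cycleHypergraph_exists_int {N : ℕ} {c p : ZMod N → ℕ} {n : ℕ} {x y : CycleVertex c p}
    (h : (cycleHypergraph c p).HasBergePath (n + 1) x y) :
    ∃ a : ℤ, -(n + 1) ≤ a ∧ a ≤ n ∧ y ∈ edge (index x + (a : ZMod N)) := by
  induction n generalizing y with
  | zero =>
    obtain ⟨z, _, ⟨i, rfl⟩, hz, hzi, hyi⟩ := h.exists_last
    obtain rfl := hz.eq_of_zero
    rcases index_eq_of_mem hzi with hi | hi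
    · exact ⟨0, by simp, by simp, by simpa [hi] using hyi⟩
    · exact ⟨-1, by simp, by simp, by simpa [hi] using hyi⟩
  | succ n ih =>
    obtain ⟨z, _, ⟨i, rfl⟩, hz, hzi, hyi⟩ := h.exists_last
    obtain ⟨a, ha1, ha2, hza⟩ := ih hz
    have hi : ∃ b : ℤ, -1 ≤ b ∧ b ≤ 1 ∧ i = index x + (a : ZMod N) + (b : ZMod N) := by
      rcases index_eq_of_mem hza with h1 | h1 <;> rcases index_eq_of_mem hzi with h2 | h2 <;>
        rw [h1] at h2
      · exact ⟨0, by simp, by simp, by simp [h2]⟩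
      · exact ⟨-1, by simp, by simp, by simp [h2]⟩
      · exact ⟨1, by simp, by simp, by simp [← h2]⟩
      · exact ⟨0, by simp, by simp, by simpa using (add_right_cancel h2).symm⟩
    obtain ⟨b, hb1, hb2, hi⟩ := hi
    refine ⟨a + b, by push_cast; omega, by push_cast; omega, ?_⟩
    rw [hi, add_assoc] at hyi
    exact_mod_cast hyi

/-- In a cycle of `2 l + 1` edges, the private vertices of the edge opposite to `x` are at distance
more than `l` from `x`. -/
theorem cycleHypergraph_mem_distConnOrders {k l : ℕ} (hl : 1 ≤ l) {c p : ZMod (2 * l + 1) → ℕ}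
    (hc : ∀ i, 0 < c i) (hp : ∀ i, 0 < p i) (hk : ∀ i, c i + c (i + 1) + p i = k) :
    ∑ i, c i + ∑ i, p i ∈ distConnOrders k 2 l := by
  have : Fact (1 < 2 * l + 1) := ⟨by omega⟩
  have hconn : ∀ (m : ℕ) (x y : CycleVertex c p), index y = index x + m →
      ∃ n, (cycleHypergraph c p).HasBergePath n x y := by
    intro m
    induction m with
    | zero =>
      intro x y h
      refine ⟨1, hasBergePath_one (Set.mem_range_self (index x)) (mem_edge_index x) ?_⟩
      have := mem_edge_index y
      simpa [h] using this
    | succ m ih =>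
      intro x y h
      let z : CycleVertex c p := Sum.inl ⟨index x + (m : ZMod (2 * l + 1)), ⟨0, hc _⟩⟩
      let w : CycleVertex c p := Sum.inl ⟨index x + (m : ZMod (2 * l + 1)) + 1, ⟨0, hc _⟩⟩
      obtain ⟨n, hn⟩ := ih x z rfl
      have hw : w ∈ edge (index x + (m : ZMod (2 * l + 1))) := Or.inl (Or.inr ⟨_, rfl⟩)
      have hy : y ∈ edge (index x + (m : ZMod (2 * l + 1)) + 1) := by
        have := mem_edge_index y
        rwa [h, Nat.cast_succ, ← add_assoc] at this
      exact ⟨_, (hn.snoc (Set.mem_range_self _) (mem_edge_index z) hw).snoc (Set.mem_range_self _)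
        (mem_edge_index w) hy⟩
  have hne : (cycleHypergraph c p).vertexSet.Nonempty := ⟨Sum.inl ⟨0, ⟨0, hc 0⟩⟩, Set.mem_univ _⟩
  refine ⟨CycleVertex c p, cycleHypergraph c p, ?_, ?_, ⟨hne, fun x _ y _ => ?_⟩, ?_⟩
  · rw [cycleHypergraph, Set.encard_univ, ENat.card_eq_coe_fintype_card]
    simp
  · rintro _ ⟨i, rfl⟩
    rw [encard_edge one_ne_zero, hk]
  · exact hconn (index y - index x).val x y (by simp)
  · refine two_le_distDomNumber hne fun x _ =>
      ⟨Sum.inr ⟨index x + ((l : ℤ) : ZMod (2 * l + 1)), ⟨0, hp _⟩⟩, Set.mem_univ _, fun n hn h => ?_⟩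
    have key : ∀ a : ℤ, -l ≤ a → a < l → index x + ((l : ℤ) : ZMod (2 * l + 1)) ≠ index x + a := by
      intro a ha1 ha2 h
      have h' := (ZMod.intCast_eq_intCast_iff_dvd_sub _ _ _).1 (add_left_cancel h).symm
      have := Int.le_of_dvd (by omega) h'
      push_cast at this
      omega
    rcases n with _ | n
    · have := congrArg index h.eq_of_zero
      refine key 0 (by omega) (by omega) ?_
      rw [Int.cast_zero, add_zero]
      exact this.symm
    · obtain ⟨a, ha1, ha2, ha⟩ := cycleHypergraph_exists_int h
      exact key a (by omega) (by omega) (eq_of_inr_mem ha)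

/-- In a cycle of odd length `2 l + 1` no two consecutive numbers of shared vertices are both
`⌊k / 2⌋`, if this value is taken at the odd indices only. -/
theorem odd_cycleHypergraph_mem_distConnOrders {k l : ℕ} (hk : 3 ≤ k) (hl : 1 ≤ l) :
    (2 * l + 1) * k - (l * (k / 2) + (l + 1) * ((k - 1) / 2)) ∈ distConnOrders k 2 l := by
  have : Fact (1 < 2 * l + 1) := ⟨by omega⟩
  let g : ℕ → ℕ := fun j => if Odd j then k / 2 else (k - 1) / 2
  let c : ZMod (2 * l + 1) → ℕ := fun i => g i.val
  have hcle : ∀ i, c i + c (i + 1) < k := by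
    intro i
    have hval : (i + 1).val = (i.val + 1) % (2 * l + 1) := by
      rw [ZMod.val_add, ZMod.val_one]
    have hlt := ZMod.val_lt i
    simp only [c, g, hval]
    by_cases h : i.val + 1 < 2 * l + 1
    · rw [Nat.mod_eq_of_lt h]
      simp only [Nat.odd_add_one]
      split_ifs <;> omega
    · rw [show i.val = 2 * l by omega, Nat.mod_self]
      simp only [Nat.not_odd_zero, if_false]
      rw [if_neg (by simp)]
      omega
  have hsum : ∑ i, c i = l * (k / 2) + (l + 1) * ((k - 1) / 2) := by
    have h1 : ∑ i, c i = ∑ j ∈ Finset.range (2 * l + 1), g j :=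
      Fin.sum_univ_eq_sum_range g (2 * l + 1)
    have h2 : ∀ m, ∑ j ∈ Finset.range (2 * m + 1), g j = m * (k / 2) + (m + 1) * ((k - 1) / 2) := by
      intro m
      induction m with
      | zero => simp [g]
      | succ m ih =>
        have e1 : g (2 * m + 1) = k / 2 := by simp [g]
        have e2 : g (2 * m + 1 + 1) = (k - 1) / 2 := if_neg (by
          rw [Nat.not_odd_iff_even]
          exact ⟨m + 1, by ring⟩)
        rw [show 2 * (m + 1) + 1 = 2 * m + 1 + 1 + 1 by ring, Finset.sum_range_succ,
          Finset.sum_range_succ, ih, e1, e2]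
        ring
    rw [h1, h2]
  have hmem := cycleHypergraph_mem_distConnOrders (k := k) hl (c := c)
    (p := fun i => k - (c i + c (i + 1)))
    (fun i => by simp only [c, g]; split_ifs <;> omega)
    (fun i => by have := hcle i; omega) (fun i => by have := hcle i; omega)
  convert hmem using 1
  have hshift : ∑ i, c (i + 1) = ∑ i, c i := Equiv.sum_comp (Equiv.addRight 1) c
  have htotal : ∑ i, (c i + c (i + 1) + (k - (c i + c (i + 1)))) = (2 * l + 1) * k := by
    rw [Finset.sum_congr rfl fun i _ => show _ = k by have := hcle i; omega]
    simp
  rw [Finset.sum_add_distrib, Finset.sum_add_distrib, hshift] at htotal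
  omega

end Hypergraph

/-! ### Bounds for the minimum order -/

namespace Hypergraph

lemma ndc_le_ndcUpper {k γ : ℕ} (hk : 2 ≤ k) (hγ : 2 ≤ γ) (l : ℕ) :
    (ndc k γ l : ℝ) ≤ ndcUpper k γ l := by
  rcases Nat.even_or_odd' l with ⟨m, rfl | rfl⟩
  · have h : ndc k γ (2 * m) ≤ m * k * γ + max k γ :=
      Nat.sInf_le (two_mul_mem_distConnOrders hk (by omega) m)
    rw [ndcUpper, if_pos (even_two_mul m)]
    refine (Nat.cast_le.2 h).trans_eq ?_
    push_cast
    ring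
  · have h : ndc k γ (2 * m + 1) ≤ (m + 1) * k * γ :=
      Nat.sInf_le (two_mul_add_one_mem_distConnOrders hk hγ m)
    rw [ndcUpper, if_neg (by simp)]
    refine (Nat.cast_le.2 h).trans_eq ?_
    push_cast
    ring

lemma distConnOrders_nonempty {k γ : ℕ} (hk : 2 ≤ k) (hγ : 2 ≤ γ) (l : ℕ) :
    (distConnOrders k γ l).Nonempty := by
  rcases Nat.even_or_odd' l with ⟨m, rfl | rfl⟩
  · exact ⟨_, two_mul_mem_distConnOrders hk (by omega) m⟩
  · exact ⟨_, two_mul_add_one_mem_distConnOrders hk hγ m⟩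

lemma mul_le_ndc {k γ l s : ℕ} (hk : 2 ≤ k) (hγ : 2 ≤ γ) (hs : 2 * (s + 1) ≤ l) :
    γ * (s + 1) * k ≤ ndc k γ l :=
  mul_le_of_mem_distConnOrders (by omega) hγ hs (Nat.sInf_mem (distConnOrders_nonempty hk hγ l))

lemma ndc_two_le_mul {k : ℕ} (hk : 2 ≤ k) (l : ℕ) : ndc k 2 l ≤ (l + 1) * k := by
  rcases Nat.even_or_odd' l with ⟨m, rfl | rfl⟩
  · refine (Nat.sInf_le (two_mul_mem_distConnOrders hk (by omega) m)).trans_eq ?_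
    rw [max_eq_left hk]
    ring
  · refine (Nat.sInf_le (two_mul_add_one_mem_distConnOrders hk le_rfl m)).trans_eq ?_
    ring

/-- The bound `⌈(2 l + 1) (k + 1) / 2⌉`. For `k = 2` there is no cycle with shared vertices and private
ones in each edge, but the spider is smaller anyway. -/
lemma two_mul_ndc_two_le {k l : ℕ} (hk : 2 ≤ k) (hl : 1 ≤ l) :
    2 * ndc k 2 l ≤ (2 * l + 1) * (k + 1) + 1 := by
  rcases hk.eq_or_lt with rfl | hk
  · have := ndc_two_le_mul le_rfl l
    omega
  · have h := Nat.sInf_le (odd_cycleHypergraph_mem_distConnOrders hk hl)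
    change ndc k 2 l ≤ _ at h
    rcases Nat.even_or_odd' k with ⟨a, rfl | rfl⟩
    · obtain ⟨a, rfl⟩ : ∃ b, a = b + 1 := ⟨a - 1, by omega⟩
      rw [show 2 * (a + 1) / 2 = a + 1 by omega, show (2 * (a + 1) - 1) / 2 = a by omega,
        show (2 * l + 1) * (2 * (a + 1)) - (l * (a + 1) + (l + 1) * a) =
          (2 * l + 1) * (a + 1) + l + 1 by
            refine Nat.sub_eq_of_eq_add ?_
            ring] at h
      linarith
    · rw [show (2 * a + 1) / 2 = a by omega, show (2 * a + 1 - 1) / 2 = a by omega,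
        show (2 * l + 1) * (2 * a + 1) - (l * a + (l + 1) * a) = (2 * l + 1) * (a + 1) by
            refine Nat.sub_eq_of_eq_add ?_
            ring] at h
      linarith

end Hypergraph

theorem theorem2 :
    (∀ k l : ℕ, 2 ≤ k → 2 ≤ l →
      (2 * (l : ℝ) + 1) * k / 2 ≤ (Hypergraph.ndc k 2 l : ℝ) ∧
      (Hypergraph.ndc k 2 l : ℝ) ≤
        min (⌈(2 * (l : ℝ) + 1) * ((k : ℝ) + 1) / 2⌉ : ℝ) (((l : ℝ) + 1) * k)) ∧
    (∀ k l γ : ℕ, 2 ≤ k → 4 ≤ l → 3 ≤ γ →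
      (k : ℝ) * (⌈(((l : ℝ) - 1) / 2 - 1) * γ⌉ : ℝ) < (Hypergraph.ndc k γ l : ℝ) ∧
      (Hypergraph.ndc k γ l : ℝ) ≤ Hypergraph.ndcUpper k γ l) ∧
    (∀ k γ : ℕ, 2 ≤ k → 3 ≤ γ →
      k * γ ≤ Hypergraph.ndc k γ 2 ∧ Hypergraph.ndc k γ 2 ≤ k * γ + max k γ) ∧
    (∀ k γ : ℕ, 2 ≤ k → 3 ≤ γ →
      k * γ ≤ Hypergraph.ndc k γ 3 ∧ Hypergraph.ndc k γ 3 ≤ 2 * k * γ) := by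
  refine ⟨fun k l hk hl => ⟨?_, le_min ?_ ?_⟩, fun k l γ hk hl hγ => ⟨?_, ?_⟩,
    fun k γ hk hγ => ⟨?_, ?_⟩, fun k γ hk hγ => ⟨?_, ?_⟩⟩
  · have h := Hypergraph.mul_le_of_mem_distConnOrders_two (by omega) hl
      (Nat.sInf_mem (Hypergraph.distConnOrders_nonempty hk le_rfl l))
    have h' : ((2 * l + 1) * k : ℝ) ≤ 2 * Hypergraph.ndc k 2 l := by exact_mod_cast h
    linarith
  · -- An integer at most `x + 1 / 2`, where `2 x` is an integer, is at most `⌈x⌉`.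
    have h : (2 * Hypergraph.ndc k 2 l : ℝ) ≤ (2 * l + 1) * (k + 1) + 1 := by
      exact_mod_cast Hypergraph.two_mul_ndc_two_le hk (by omega : 1 ≤ l)
    have h1 := Int.le_ceil ((2 * (l : ℝ) + 1) * ((k : ℝ) + 1) / 2)
    have h2 : ((Hypergraph.ndc k 2 l : ℤ) : ℝ) <
        (⌈(2 * (l : ℝ) + 1) * ((k : ℝ) + 1) / 2⌉ : ℝ) + 1 := by
      push_cast
      linarith
    have h3 : (Hypergraph.ndc k 2 l : ℤ) ≤ ⌈(2 * (l : ℝ) + 1) * ((k : ℝ) + 1) / 2⌉ :=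
      Int.lt_add_one_iff.1 (by exact_mod_cast h2)
    exact_mod_cast h3
  · exact_mod_cast Hypergraph.ndc_two_le_mul hk l
  · obtain ⟨m, hm⟩ : ∃ m, l / 2 = m + 1 := ⟨l / 2 - 1, by omega⟩
    have h := Hypergraph.mul_le_ndc hk (by omega : 2 ≤ γ) (show 2 * (m + 1) ≤ l by omega)
    have hlm : (l : ℝ) ≤ 2 * m + 3 := by exact_mod_cast (show l ≤ 2 * m + 3 by omega)
    have hγ' : (3 : ℝ) ≤ γ := by exact_mod_cast hγ
    have hk' : (0 : ℝ) < k := by exact_mod_cast (show 0 < k by omega)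
    have hceil : ⌈(((l : ℝ) - 1) / 2 - 1) * γ⌉ ≤ (m * γ : ℤ) := by
      refine Int.ceil_le.2 ?_
      push_cast
      exact mul_le_mul_of_nonneg_right (by linarith) (by linarith)
    have hceil' : (⌈(((l : ℝ) - 1) / 2 - 1) * γ⌉ : ℝ) ≤ m * γ := by exact_mod_cast hceil
    have h' : (γ * (m + 1) * k : ℝ) ≤ Hypergraph.ndc k γ l := by exact_mod_cast h
    calc (k : ℝ) * (⌈(((l : ℝ) - 1) / 2 - 1) * γ⌉ : ℝ) ≤ k * (m * γ) := by gcongr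
      _ < γ * (m + 1) * k := by nlinarith
      _ ≤ _ := h'
  · exact Hypergraph.ndc_le_ndcUpper hk (by omega) l
  · have := Hypergraph.mul_le_ndc (s := 0) hk (by omega : 2 ≤ γ) (show 2 * (0 + 1) ≤ 2 by omega)
    linarith
  · refine (Nat.sInf_le (Hypergraph.two_mul_mem_distConnOrders hk (by omega) 1)).trans_eq ?_
    ring
  · have := Hypergraph.mul_le_ndc (s := 0) hk (by omega : 2 ≤ γ) (show 2 * (0 + 1) ≤ 3 by omega)
    linarith
  · exact Nat.sInf_le (Hypergraph.two_mul_add_one_mem_distConnOrders hk (by omega) 1)
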